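/- Maps and morphisms are composed from left to right. **Concordant semigroups.** In a semigroup $S$, $a\,\mathscr L^*\,b$ ($a\,\mathscr R^*\,b$) means that $a,b$ are $\mathscr L$-related ($\mathscr R$-related) in some oversemigroup of $S$. $S$ is *concordant* if (i) each $\mathscr L^*$-class and each $\mathscr R^*$-class contains an idempotent; (ii) for each $a\in S$ there are idempotents $a^\dagger\,\mathscr R^*\,a\,\mathscr L^*\,a^*$ and a bijection $\alpha\colon\langle a^\dagger\rangle\to\langle a^*\rangle$ with $xa=a(x\alpha)$, where $\langle e\rangle$ is the subsemigroup generated by the idempotents $g=ge=eg$; (iii) the idempotents generate a regular subsemigroup. A *good homomorphism* is a homomorphism preserving $\mathscr L^*$ and $\mathscr R^*$; $\mathbf{CS}$ is the category of concordant semigroups and good homomorphisms. **Consistent categories.** A *category with subobjects* is a small category $\mathcal C$ with a distinguished subcategory of *inclusions*, containing all identities, which is a strict preorder (at most one inclusion $j_a^b\colon a\to b$ between two objects; we then write $a\subseteq b$, and $\subseteq$ is antisymmetric), whose members are monomorphisms, and such that $h$ is an inclusion whenever $g$ and $hg$ are. A *retraction* is a right inverse of an inclusion, a *bimorphism* is a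 morphism that is mono and epi. A *consistent* (*normal*) *factorization* of $f$ is $f=quj$ with $q$ a retraction, $u$ a bimorphism (isomorphism) and $j$ an inclusion; $f^\circ=qu$ is the epimorphic component of $f$ and its codomain is $\operatorname{im}f$. A *consistent cone* $\gamma$ with vertex $c_\gamma$ is a family $\gamma(a)\colon a\to c_\gamma$ ($a\in v\mathcal C$) with $j_a^b\gamma(b)=\gamma(a)$ for $a\subseteq b$ and with at least one component a bimorphism. For $c\in v\mathcal C$ let $\langle c\rangle$ be the category whose objects are the subobjects of $c$ and whose morphisms are generated by the inclusions and retractions among them. $\mathcal C$ is a *consistent category* if inclusions split, every morphism has a consistent factorization, every product (inclusion)(retraction) has a normal factorization, for each $c$ there is a consistent cone $\epsilon$ with $\epsilon(c)=1_c$, and every bimorphism $u\colon c\to d$ is *consistent*: there is a unique isomorphism of categories $T\colon\langle c\rangle\to\langle d\rangle$ with $T(c')=\operatorname{im}(j_{c'}^cu)$, preserving inclusions, for which the morphisms $(j_{c'}^cu)^\circ\colon c'\to T(c')$ are natural in $c'\in\langle c\rangle$. For a cone $\gamma$ and $f\colon c_\gamma\to d$, the cone $\gamma*f^\circ$ has vertex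 $\operatorname{im} f$ and components $\gamma(a)f^\circ$. Consistent cones form a semigroup under $\gamma\cdot\gamma'=\gamma*(\gamma'(c_\gamma))^\circ$. For an idempotent cone $\epsilon$, the functor $H(\epsilon;-)\colon\mathcal C\to\mathbf{Set}$ is given by $H(\epsilon;c)=\{\epsilon*f^\circ: f\in\mathcal C(c_\epsilon,c)\}$ and $H(\epsilon;g)\colon\epsilon*f^\circ\mapsto\epsilon*(fg)^\circ$; $\eta_\epsilon\colon H(\epsilon;-)\to\mathcal C(c_\epsilon,-)$ is the natural isomorphism $\epsilon*f^\circ\mapsto f$, and $MH(\epsilon;-)=\{c:\epsilon(c)\text{ is an isomorphism}\}$. The *consistent dual* $\mathcal C^*$ is the full subcategory of $[\mathcal C,\mathbf{Set}]$ on the functors $H(\epsilon;-)$; its inclusions are the natural transformations whose components are inclusions of sets. **Cross-connections.** A *local isomorphism* is an inclusion-preserving fully faithful functor $F$ that restricts to isomorphisms $\langle c\rangle\to\langle F(c)\rangle$ for all objects $c$. A *cross-connection* $\Omega=(\mathcal C,\mathcal D;\Gamma,\Delta)$ consists of consistent categories $\mathcal C,\mathcal D$ and local isomorphisms $\Gamma\colon\mathcal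 D\to\mathcal C^*$, $\Delta\colon\mathcal C\to\mathcal D^*$ with $c\in M\Gamma(d)\iff d\in M\Delta(c)$. Let $E_\Omega=\{(c,d):c\in M\Gamma(d)\}$. For $(c,d)\in E_\Omega$, $\gamma(c,d)$ is the idempotent cone in $\mathcal C$ with vertex $c$ and $H(\gamma(c,d);-)=\Gamma(d)$, and $\delta(c,d)$ is the idempotent cone in $\mathcal D$ with vertex $d$ and $H(\delta(c,d);-)=\Delta(c)$. For $(c',d),(c,d')\in E_\Omega$ the *transpose* of $f\colon c'\to c$ is the $f^\ddagger=g\colon d'\to d$ with $\Delta(f)\,\eta_{\delta(c,d')}=\eta_{\delta(c',d)}\,\mathcal D(g,-)$. The *cross-connection semigroup* $\mathbb S\Omega$ is the set of *linked pairs* $(\gamma(c',d)*f^\circ,\ \delta(c,d')*(f^\ddagger)^\circ)$, where $(c',d),(c,d')\in E_\Omega$ and $f\colon c'\to c$, with the product $(\gamma,\delta)(\gamma',\delta')=(\gamma\cdot\gamma',\delta'\cdot\delta)$. A *CC-morphism* $m\colon\Omega\to\Omega'$ is a pair of functors $F\colon\mathcal C\to\mathcal C'$, $G\colon\mathcal D\to\mathcal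 D'$ that preserve inclusions and bimorphisms, map $E_\Omega$ to $E_{\Omega'}$, and satisfy $F(\gamma(c,d)(a))=\gamma(F(c),G(d))(F(a))$ and $G(f^\ddagger)=F(f)^\ddagger$. Then $\mathbb Sm$ is defined by $(\gamma(c',d)*u,\delta(c,d')*u^\ddagger)\mapsto(\gamma(F(c'),G(d))*F(u),\delta(F(c),G(d'))*G(u^\ddagger))$ for bimorphisms $u\colon c'\to c$. **The functor $\mathbb C$.** For a concordant semigroup $S$, $\mathbb L(S)$ has the objects $Se$ ($e^2=e$) and the morphisms $\rho(e,u,f)\colon Se\to Sf$, $x\mapsto xu$ ($u\in eSf$), and inclusions are set inclusions; $\mathbb R(S)$ has the objects $eS$ and the morphisms $\lambda(e,u,f)\colon eS\to fS$, $x\mapsto ux$ ($u\in fSe$). For $a\in S$ the principal cone $\rho^a$ in $\mathbb L(S)$ has vertex $Sf$, where $f=f^2\,\mathscr L^*\,a$, and components $\rho^a(Se)=\rho(e,ea,f)$; $\lambda^a$ is defined dually in $\mathbb R(S)$. Put $\mathbb C(S)=\Omega S=(\mathbb L(S),\mathbb R(S);\Gamma_S,\Delta_S)$, where $\Gamma_S(eS)=H(\rho^e;-)$,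 $\Gamma_S(\lambda(e,u,f))=\eta_{\rho^e}\,\mathbb L(S)(\rho(f,u,e),-)\,\eta_{\rho^f}^{-1}$ and $\Delta_S$ is defined dually. For a good homomorphism $h\colon S\to S'$ put $\mathbb C(h)=\Omega h=(F_h,G_h)$, where $F_h(Se)=S'(eh)$, $F_h(\rho(e,u,f))=\rho(eh,uh,fh)$, and $G_h$ is defined dually. **Theorem.** For every concordant semigroup $S$, $\Omega S$ is a cross-connection, and for every good homomorphism $h$, $\Omega h$ is a CC-morphism. $\mathbb S\Omega S$ is a concordant semigroup, $\mathbb S\Omega h$ is a well-defined good homomorphism, and $S\mapsto\mathbb S\Omega S$, $h\mapsto\mathbb S\Omega h$ is a functor $\mathbf{CS}\to\mathbf{CS}$ (the composite of $\mathbb C$ and $\mathbb S$). For each concordant semigroup $S$, the map $\varphi(S)\colon a\mapsto(\rho^a,\lambda^a)$ is an isomorphism $S\to\mathbb S\Omega S$, and $S\mapsto\varphi(S)$ is a natural isomorphism from the identity functor $1_{\mathbf{CS}}$ to this functor. -/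

import Mathlib

open CategoryTheory MulOpposite

universe v u v' u'

namespace CrossConnections

/-! ### Concordant semigroups -/

section Semigroups

/-- Green's relation `L` on a semigroup `T`: `T¹ a = T¹ b`. -/
def GreenL {T : Type u} [Semigroup T] (a b : T) : Prop :=
  (a = b ∨ ∃ s, a = s * b) ∧ (b = a ∨ ∃ s, b = s * a)

/-- Green's relation `R` on a semigroup `T`: `a T¹ = b T¹`. -/
def GreenR {T : Type u} [Semigroup T] (a b : T) : Prop :=
  (a = b ∨ ∃ s, a = b * s) ∧ (b = a ∨ ∃ s, b = a * s)

/-- `a L* b` in `S`: `a` and `b` are `L`-related in some oversemigroup of `S`. -/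
def LStar {S : Type u} [Semigroup S] (a b : S) : Prop :=
  ∃ (T : Type u) (_ : Semigroup T) (i : S →ₙ* T), Function.Injective i ∧ GreenL (i a) (i b)

/-- `a R* b` in `S`: `a` and `b` are `R`-related in some oversemigroup of `S`. -/
def RStar {S : Type u} [Semigroup S] (a b : S) : Prop :=
  ∃ (T : Type u) (_ : Semigroup T) (i : S →ₙ* T), Function.Injective i ∧ GreenR (i a) (i b)

/-- Every `L*`-class and every `R*`-class contains an idempotent. -/
class Abundant (S : Type u) [Semigroup S] : Prop where
  exists_lstar : ∀ a : S, ∃ e : S, IsIdempotentElem e ∧ LStar a e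
  exists_rstar : ∀ a : S, ∃ e : S, IsIdempotentElem e ∧ RStar a e

/-- The subsemigroup `⟨e⟩` generated by the idempotents `g` with `g e = e g = g`. -/
def omegaSpan {S : Type u} [Semigroup S] (e : S) : Subsemigroup S :=
  Subsemigroup.closure {g | IsIdempotentElem g ∧ g * e = g ∧ e * g = g}

/-- Every `a` admits a connecting bijection `α : ⟨a†⟩ → ⟨a*⟩` with `x a = a (x α)`. -/
def IdempotentConnected (S : Type u) [Semigroup S] : Prop :=
  ∀ a : S, ∃ e f : S, IsIdempotentElem e ∧ RStar a e ∧ IsIdempotentElem f ∧ LStar a f ∧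
    ∃ α : omegaSpan e ≃ omegaSpan f, ∀ x : omegaSpan e, (x : S) * a = a * (α x : S)

/-- Concordant semigroups: abundant, idempotent-connected, and the idempotents generate a
regular subsemigroup. -/
class Concordant (S : Type u) [Semigroup S] : Prop extends Abundant S where
  idempotentConnected : IdempotentConnected S
  regular : ∀ x ∈ Subsemigroup.closure {e : S | IsIdempotentElem e},
    ∃ y ∈ Subsemigroup.closure {e : S | IsIdempotentElem e}, x * y * x = x

theorem LStar.mul_eq {S : Type u} [Semigroup S] {a e : S} (h : LStar a e)
    (he : IsIdempotentElem e) : a * e = a := by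
  obtain ⟨T, _, i, hi, h1, -⟩ := h
  apply hi
  have hie : i e * i e = i e := by rw [← map_mul, he.eq]
  rcases h1 with h1 | ⟨s, h1⟩
  · rw [map_mul, h1, hie]
  · rw [map_mul, h1, mul_assoc, hie]

theorem LStar.cancel {S : Type u} [Semigroup S] {a e x y : S} (h : LStar a e)
    (hxy : a * x = a * y) : e * x = e * y := by
  obtain ⟨T, _, i, hi, -, h1⟩ := h
  apply hi
  have hi' : i a * i x = i a * i y := by rw [← map_mul, hxy, map_mul]
  rcases h1 with h1 | ⟨s, h1⟩
  · rw [map_mul, map_mul, h1, hi']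
  · rw [map_mul, map_mul, h1, mul_assoc, hi', mul_assoc]

theorem lstar_op_of_rstar {S : Type u} [Semigroup S] {a b : S} (h : RStar a b) :
    LStar (op a) (op b) := by
  obtain ⟨T, _, i, hi, h1, h2⟩ := h
  refine ⟨Tᵐᵒᵖ, inferInstance, MulHom.op i, ?_, ?_, ?_⟩
  · intro x y hxy
    exact unop_injective (hi (op_injective hxy))
  · exact h1.imp (fun h => congrArg op h) fun ⟨s, h⟩ => ⟨op s, congrArg op h⟩
  · exact h2.imp (fun h => congrArg op h) fun ⟨s, h⟩ => ⟨op s, congrArg op h⟩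

theorem rstar_op_of_lstar {S : Type u} [Semigroup S] {a b : S} (h : LStar a b) :
    RStar (op a) (op b) := by
  obtain ⟨T, _, i, hi, h1, h2⟩ := h
  refine ⟨Tᵐᵒᵖ, inferInstance, MulHom.op i, ?_, ?_, ?_⟩
  · intro x y hxy
    exact unop_injective (hi (op_injective hxy))
  · exact h1.imp (fun h => congrArg op h) fun ⟨s, h⟩ => ⟨op s, congrArg op h⟩
  · exact h2.imp (fun h => congrArg op h) fun ⟨s, h⟩ => ⟨op s, congrArg op h⟩

theorem RStar.eq_mul {S : Type u} [Semigroup S] {a e : S} (h : RStar a e)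
    (he : IsIdempotentElem e) : e * a = a :=
  op_injective ((lstar_op_of_rstar h).mul_eq (congrArg op he))

theorem RStar.cancel {S : Type u} [Semigroup S] {a e x y : S} (h : RStar a e)
    (hxy : x * a = y * a) : x * e = y * e :=
  op_injective ((lstar_op_of_rstar h).cancel (x := op x) (y := op y) (congrArg op hxy))

instance (S : Type u) [Semigroup S] [Abundant S] : Abundant Sᵐᵒᵖ where
  exists_lstar a := by
    obtain ⟨e, he, h⟩ := Abundant.exists_rstar (unop a)
    exact ⟨op e, congrArg op he, lstar_op_of_rstar h⟩
  exists_rstar a := by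
    obtain ⟨e, he, h⟩ := Abundant.exists_lstar (unop a)
    exact ⟨op e, congrArg op he, rstar_op_of_lstar h⟩

/-- The objects of the category `CS`. -/
structure ConcSemigroup : Type (u + 1) where
  carrier : Type u
  [semigroup : Semigroup carrier]
  [concordant : Concordant carrier]

attribute [instance] ConcSemigroup.semigroup ConcSemigroup.concordant

/-- Good homomorphisms: semigroup homomorphisms that preserve `L*` and `R*`. -/
@[ext]
structure GoodHom (S T : ConcSemigroup.{u}) where
  toMulHom : S.carrier →ₙ* T.carrier
  map_lstar : ∀ a b, LStar a b → LStar (toMulHom a) (toMulHom b)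
  map_rstar : ∀ a b, RStar a b → RStar (toMulHom a) (toMulHom b)

/-- The category `CS` of concordant semigroups and good homomorphisms. -/
instance : Category ConcSemigroup.{u} where
  Hom := GoodHom
  id S := ⟨MulHom.id _, fun _ _ h => h, fun _ _ h => h⟩
  comp f g := ⟨g.toMulHom.comp f.toMulHom,
    fun a b h => g.map_lstar _ _ (f.map_lstar a b h),
    fun a b h => g.map_rstar _ _ (f.map_rstar a b h)⟩

end Semigroups

/-! ### Categories with subobjects, consistent cones -/

/-- A category with a distinguished class of morphisms, called inclusions. -/
class HasInclusions (C : Type u) [Category.{v} C] where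
  IsIncl : ∀ {a b : C}, (a ⟶ b) → Prop

open HasInclusions

/-- `a ⊆ b`: there is an inclusion from `a` to `b`. -/
def Sub {C : Type u} [Category.{v} C] [HasInclusions C] (a b : C) : Prop :=
  ∃ j : a ⟶ b, IsIncl j

/-- A category with subobjects: the inclusions form a subcategory with the same objects which is a
strict preorder, inclusions are monomorphisms, and `h` is an inclusion as soon as `h g` and `g`
are inclusions. -/
class CategoryWithSubobjects (C : Type u) [Category.{v} C] [HasInclusions C] : Prop where
  incl_id : ∀ a : C, IsIncl (𝟙 a)
  incl_comp : ∀ {a b c : C} (f : a ⟶ b) (g : b ⟶ c), IsIncl f → IsIncl g → IsIncl (f ≫ g)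
  incl_unique : ∀ {a b : C} (f g : a ⟶ b), IsIncl f → IsIncl g → f = g
  incl_antisymm : ∀ {a b : C} (f : a ⟶ b) (g : b ⟶ a), IsIncl f → IsIncl g → a = b
  incl_mono : ∀ {a b : C} (f : a ⟶ b), IsIncl f → Mono f
  incl_of_comp : ∀ {a b c : C} (h : a ⟶ b) (g : b ⟶ c), IsIncl g → IsIncl (h ≫ g) → IsIncl h

/-- Retractions: right inverses of inclusions. -/
def IsRetraction {C : Type u} [Category.{v} C] [HasInclusions C] {a b : C} (q : a ⟶ b) : Prop :=
  ∃ j : b ⟶ a, IsIncl j ∧ j ≫ q = 𝟙 b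

/-- Bimorphisms: morphisms that are right and left cancellable. -/
def IsBimorphism {C : Type u} [Category.{v} C] {a b : C} (f : a ⟶ b) : Prop :=
  Mono f ∧ Epi f

/-- `f = q u j` with `q` a retraction, `u` a bimorphism, `j` an inclusion. -/
structure ConsistentFactorization {C : Type u} [Category.{v} C] [HasInclusions C] {a b : C}
    (f : a ⟶ b) where
  mid : C
  im : C
  q : a ⟶ mid
  u : mid ⟶ im
  j : im ⟶ b
  retraction : IsRetraction q
  bimorphism : IsBimorphism u
  incl : IsIncl j
  fac : q ≫ u ≫ j = f

/-- `f` has a normal factorization: `f = q u j` with `q` a retraction, `u` an isomorphism, `j` an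
inclusion. -/
def HasNormalFactorization {C : Type u} [Category.{v} C] [HasInclusions C] {a b : C}
    (f : a ⟶ b) : Prop :=
  ∃ (c d : C) (q : a ⟶ c) (u : c ⟶ d) (j : d ⟶ b),
    IsRetraction q ∧ IsIso u ∧ IsIncl j ∧ q ≫ u ≫ j = f

/-- The first three axioms of consistent categories: a category with subobjects, in which every
inclusion splits and every morphism has a consistent factorization. -/
class FactorizationCategory (C : Type u) [Category.{v} C] [HasInclusions C] : Prop
    extends CategoryWithSubobjects C where
  split : ∀ {a b : C} (j : a ⟶ b), IsIncl j → ∃ q : b ⟶ a, j ≫ q = 𝟙 a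
  factor : ∀ {a b : C} (f : a ⟶ b), Nonempty (ConsistentFactorization f)

section Cones

variable {C : Type u} [Category.{v} C] [HasInclusions C]

/-- A consistent cone with vertex `d`. -/
@[ext]
structure ConeAt (d : C) where
  app : ∀ a : C, a ⟶ d
  compat : ∀ {a b : C} (j : a ⟶ b), IsIncl j → j ≫ app b = app a
  exists_bimorphism : ∃ c : C, IsBimorphism (app c)

variable (C) in
/-- The set of all consistent cones; the first component of `γ` is its vertex. -/
abbrev Cones : Type (max u v) := Σ d : C, ConeAt d

theorem epi_fac {a b : C} {f : a ⟶ b} (F : ConsistentFactorization f) : Epi (F.q ≫ F.u) := by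
  obtain ⟨j, -, hj⟩ := F.retraction
  have := F.bimorphism.2
  have : IsSplitEpi F.q := ⟨⟨⟨j, hj⟩⟩⟩
  exact epi_comp _ _

section Fact

variable [FactorizationCategory C]

/-- A consistent factorization of `f`. -/
noncomputable def theFac {a b : C} (f : a ⟶ b) : ConsistentFactorization f :=
  (FactorizationCategory.factor f).some

/-- The image of `f`. -/
noncomputable def im {a b : C} (f : a ⟶ b) : C := (theFac f).im

/-- The epimorphic component `f° = q u` of `f = q u j`. -/
noncomputable def epiPart {a b : C} (f : a ⟶ b) : a ⟶ im f := (theFac f).q ≫ (theFac f).u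

/-- The inclusion `j` of the image of `f = q u j`. -/
noncomputable def imIncl {a b : C} (f : a ⟶ b) : im f ⟶ b := (theFac f).j

theorem epiPart_imIncl {a b : C} (f : a ⟶ b) : epiPart f ≫ imIncl f = f :=
  (Category.assoc _ _ _).trans (theFac f).fac

theorem isIncl_imIncl {a b : C} (f : a ⟶ b) : IsIncl (imIncl f) := (theFac f).incl

instance epi_epiPart {a b : C} (f : a ⟶ b) : Epi (epiPart f) := epi_fac (theFac f)

/-- The epimorphic component does not depend on the factorization. -/
theorem epiPart_unique {a b m n : C} {e : a ⟶ m} {j : m ⟶ b} {e' : a ⟶ n} {j' : n ⟶ b}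
    [Epi e] [Epi e'] (hj : IsIncl j) (hj' : IsIncl j') (h : e ≫ j = e' ≫ j') :
    ∃ k : m = n, e ≫ eqToHom k = e' ∧ j = eqToHom k ≫ j' := by
  obtain ⟨r, hr⟩ := FactorizationCategory.split j hj
  obtain ⟨r', hr'⟩ := FactorizationCategory.split j' hj'
  have h1 : (j ≫ r') ≫ j' = j := by
    rw [← cancel_epi e, ← Category.assoc, ← Category.assoc, h, Category.assoc e', hr']; simp
  have h2 : (j' ≫ r) ≫ j = j' := by
    rw [← cancel_epi e', ← Category.assoc, ← Category.assoc, ← h, Category.assoc e, hr]; simp [h]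
  have k : m = n := CategoryWithSubobjects.incl_antisymm (j ≫ r') (j' ≫ r)
    (CategoryWithSubobjects.incl_of_comp _ j' hj' (by rw [h1]; exact hj))
    (CategoryWithSubobjects.incl_of_comp _ j hj (by rw [h2]; exact hj'))
  subst k
  have hjj : j = j' := CategoryWithSubobjects.incl_unique _ _ hj hj'
  subst hjj
  have := CategoryWithSubobjects.incl_mono j hj
  refine ⟨rfl, ?_, by simp⟩
  rw [← cancel_mono j]; simpa using h

/-- The cone `γ * f : a ↦ γ(a) f`, for an epimorphism `f`. -/
def ConeAt.postcomp {c d : C} (γ : ConeAt c) (f : c ⟶ d) [Epi f] : ConeAt d where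
  app a := γ.app a ≫ f
  compat j hj := by rw [← Category.assoc, γ.compat j hj]
  exists_bimorphism := by
    obtain ⟨a, ha⟩ := γ.exists_bimorphism
    have := ha.2
    let F := theFac (γ.app a ≫ f)
    have hF : F.q ≫ F.u ≫ F.j = γ.app a ≫ f := F.fac
    obtain ⟨r, hr⟩ := FactorizationCategory.split F.j F.incl
    have hep : Epi (γ.app a ≫ f) := epi_comp _ _
    have := epi_fac F
    obtain ⟨k, hk, -⟩ := epiPart_unique (e := F.q ≫ F.u) (e' := γ.app a ≫ f) (j := F.j)
      (j' := 𝟙 d) F.incl (CategoryWithSubobjects.incl_id d) (by simpa using hF)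
    obtain ⟨j, hj, hjq⟩ := F.retraction
    refine ⟨F.mid, ?_⟩
    have h1 : γ.app F.mid ≫ f = F.u ≫ eqToHom k := by
      have h2 : γ.app F.mid ≫ f = j ≫ γ.app a ≫ f := by rw [← γ.compat j hj, Category.assoc]
      have h3 : j ≫ γ.app a ≫ f = j ≫ (F.q ≫ F.u) ≫ eqToHom k := congrArg (fun x => j ≫ x) hk.symm
      rw [h2, h3, Category.assoc, ← Category.assoc j, hjq, Category.id_comp]
    have := F.bimorphism.1
    have := F.bimorphism.2
    rw [h1]
    exact ⟨mono_comp _ _, epi_comp _ _⟩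

/-- The cone `γ * f°`, for an arbitrary morphism `f` from the vertex of `γ`. -/
noncomputable def ConeAt.star {c d : C} (γ : ConeAt c) (f : c ⟶ d) : Cones C :=
  ⟨im f, γ.postcomp (epiPart f)⟩

/-- `γ * f°` may be computed with any factorization of `f` into an epimorphism and an
inclusion. -/
theorem ConeAt.star_eq {c d m : C} (γ : ConeAt c) (f : c ⟶ d) (e : c ⟶ m) [Epi e] (j : m ⟶ d)
    (hj : IsIncl j) (h : e ≫ j = f) : γ.star f = ⟨m, γ.postcomp e⟩ := by
  obtain ⟨k, hk, -⟩ := epiPart_unique (e := epiPart f) (e' := e) (isIncl_imIncl f) hj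
    ((epiPart_imIncl f).trans h.symm)
  subst k
  subst hk
  simp [ConeAt.star]

/-- The product of consistent cones: `γ₁ γ₂ = γ₁ * (γ₂(c))°`, where `c` is the vertex of `γ₁`. -/
noncomputable instance : Mul (Cones C) where
  mul γ₁ γ₂ := γ₁.2.star (γ₂.2.app γ₁.1)

theorem cones_mul_def (γ₁ γ₂ : Cones C) : γ₁ * γ₂ = γ₁.2.star (γ₂.2.app γ₁.1) := rfl

theorem ConeAt.postcomp_postcomp {c d e : C} (γ : ConeAt c) (f : c ⟶ d) (g : d ⟶ e) [Epi f]
    [Epi g] [Epi (f ≫ g)] : (γ.postcomp f).postcomp g = γ.postcomp (f ≫ g) := by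
  ext a; simp [ConeAt.postcomp]

noncomputable instance : Semigroup (Cones C) where
  mul_assoc γ₁ γ₂ γ₃ := by
    obtain ⟨c₁, γ₁⟩ := γ₁
    obtain ⟨c₂, γ₂⟩ := γ₂
    obtain ⟨c₃, γ₃⟩ := γ₃
    simp only [cones_mul_def]
    have key : (γ₁.star (γ₂.app c₁)) = ⟨_, γ₁.postcomp (epiPart (γ₂.app c₁))⟩ := rfl
    rw [key]
    have h2 : (γ₂.star (γ₃.app c₂)).2.app c₁ = γ₂.app c₁ ≫ epiPart (γ₃.app c₂) := rfl
    rw [h2]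
    set f := γ₂.app c₁
    set g := γ₃.app c₂
    have h3 : γ₃.app (im f) = imIncl f ≫ g := (γ₃.compat _ (isIncl_imIncl f)).symm
    let p := imIncl f ≫ epiPart g
    have e1 : Epi (epiPart f ≫ epiPart p) := epi_comp _ _
    have lhs : (γ₁.postcomp (epiPart f)).star (γ₃.app (im f)) =
        ⟨im p, (γ₁.postcomp (epiPart f)).postcomp (epiPart p)⟩ := by
      apply ConeAt.star_eq _ _ (epiPart p) (imIncl p ≫ imIncl g)
      · exact CategoryWithSubobjects.incl_comp _ _ (isIncl_imIncl p) (isIncl_imIncl g)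
      · rw [h3, ← Category.assoc, epiPart_imIncl, Category.assoc, epiPart_imIncl]
    have rhs : γ₁.star (f ≫ epiPart g) = ⟨im p, γ₁.postcomp (epiPart f ≫ epiPart p)⟩ := by
      apply ConeAt.star_eq _ _ (epiPart f ≫ epiPart p) (imIncl p) (isIncl_imIncl p)
      rw [Category.assoc, epiPart_imIncl, ← Category.assoc, epiPart_imIncl]
    change (γ₁.postcomp (epiPart f)).star (γ₃.app (im f)) = γ₁.star (f ≫ epiPart g)
    rw [lhs, rhs, ConeAt.postcomp_postcomp]

/-- Idempotent cones: the idempotents of the semigroup of consistent cones. -/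
def ConeAt.IsIdem {c : C} (ε : ConeAt c) : Prop :=
  IsIdempotentElem (⟨c, ε⟩ : Cones C)

theorem ConeAt.isIdem_iff {c : C} (ε : ConeAt c) : ε.IsIdem ↔ ε.app c = 𝟙 c := by
  constructor
  · intro h
    have h' : ε.star (ε.app c) = ⟨c, ε⟩ := h
    obtain ⟨a, ha⟩ := ε.exists_bimorphism
    have := ha.2
    have hc : im (ε.app c) = c := congrArg Sigma.fst h'
    have hi : imIncl (ε.app c) = eqToHom hc := by
      apply CategoryWithSubobjects.incl_unique _ _ (isIncl_imIncl _)
      generalize im (ε.app c) = x at hc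
      subst hc
      exact CategoryWithSubobjects.incl_id _
    have h1 : ∀ (m : C) (e : c ⟶ m) [Epi e] (k : m = c),
        (⟨m, ε.postcomp e⟩ : Cones C) = ⟨c, ε⟩ → ε.app a ≫ e ≫ eqToHom k = ε.app a := by
      intro m e _ k hm
      subst k
      have hh : ε.postcomp e = ε := eq_of_heq (Sigma.mk.inj hm).2
      have := congrArg (fun γ => ConeAt.app γ a) hh
      simpa [ConeAt.postcomp] using this
    have h2 := h1 _ (epiPart (ε.app c)) hc h'
    rw [← hi, epiPart_imIncl] at h2
    rw [← cancel_epi (ε.app a), h2, Category.comp_id]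
  · intro h
    change ε.star (ε.app c) = ⟨c, ε⟩
    rw [ConeAt.star_eq ε (ε.app c) (𝟙 c) (𝟙 c) (CategoryWithSubobjects.incl_id c) (by simp [h])]
    congr 1
    ext a; simp [ConeAt.postcomp]

end Fact

end Cones

/-! ### Consistent categories -/

section Consistent

variable {C : Type u} [Category.{v} C] [HasInclusions C]

/-- The morphisms of `⟨c⟩`: those generated by the inclusions and the retractions among the
subobjects of `c`. -/
inductive InCore (c : C) : ∀ {a b : C}, (a ⟶ b) → Prop
  | incl {a b : C} (j : a ⟶ b) : Sub a c → Sub b c → IsIncl j → InCore c j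
  | retraction {a b : C} (q : a ⟶ b) : Sub a c → Sub b c → IsRetraction q → InCore c q
  | comp {a b d : C} (f : a ⟶ b) (g : b ⟶ d) : InCore c f → InCore c g → InCore c (f ≫ g)

/-- The objects of `⟨c⟩`: the subobjects of `c`. -/
structure CoreIdeal (c : C) where
  obj : C
  sub : Sub obj c

/-- The category `⟨c⟩`. -/
instance [CategoryWithSubobjects C] (c : C) : Category (CoreIdeal c) where
  Hom a b := {f : a.obj ⟶ b.obj // InCore c f}
  id a := ⟨𝟙 a.obj, .incl _ a.sub a.sub (CategoryWithSubobjects.incl_id _)⟩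
  comp f g := ⟨f.1 ≫ g.1, .comp _ _ f.2 g.2⟩

variable [FactorizationCategory C]

/-- `e` is the epimorphic component of `f`. -/
def IsEpiPart {a b m : C} (f : a ⟶ b) (e : a ⟶ m) : Prop :=
  ∃ h : im f = m, epiPart f ≫ eqToHom h = e

/-- The functor `T : ⟨c⟩ ⥤ ⟨d⟩` extends the functor `Tᵘ : σ(c) ⥤ σ(d)`, which sends `c'` to
`im (j u)`, where `j` is the inclusion of `c'` in `c`, and inclusions to inclusions; and the
epimorphic components of the morphisms `j u` are natural on all of `⟨c⟩`, that is, they form a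
natural transformation from the inclusion functor of `⟨c⟩` to `T`. -/
structure ExtendsNaturally {c d : C} (u : c ⟶ d) (T : CoreIdeal c ⥤ CoreIdeal d) : Prop where
  map_incl : ∀ {a b : CoreIdeal c} (j : a ⟶ b), IsIncl j.1 → IsIncl (T.map j).1
  natural : ∃ τ : ∀ a : CoreIdeal c, a.obj ⟶ (T.obj a).obj,
    (∀ (a : CoreIdeal c) (j : a.obj ⟶ c), IsIncl j → IsEpiPart (j ≫ u) (τ a)) ∧
    ∀ {a b : CoreIdeal c} (m : a ⟶ b), m.1 ≫ τ b = τ a ≫ (T.map m).1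

/-- The bimorphism `u` is consistent: `Tᵘ` has a unique extension to an isomorphism
`⟨c⟩ ⥤ ⟨d⟩` that is natural in the above sense. -/
def IsConsistentMorphism {c d : C} (u : c ⟶ d) : Prop :=
  ∃! T : CoreIdeal c ⥤ CoreIdeal d,
    (∃ T' : CoreIdeal d ⥤ CoreIdeal c, T ⋙ T' = 𝟭 _ ∧ T' ⋙ T = 𝟭 _) ∧ ExtendsNaturally u T

variable (C) in
/-- Consistent categories. -/
structure IsConsistentCategory : Prop where
  consistent : ∀ {c d : C} (u : c ⟶ d), IsBimorphism u → IsConsistentMorphism u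
  normal : ∀ {a b c : C} (j : a ⟶ b) (q : b ⟶ c), IsIncl j → IsRetraction q →
    HasNormalFactorization (j ≫ q)
  cone : ∀ c : C, ∃ ε : ConeAt c, ε.app c = 𝟙 c

end Consistent

/-! ### `H`-functors and the consistent dual -/

/-- The full subcategory of the category of sets formed by the subsets of `X`. -/
structure SubsetCat (X : Type u) where
  carrier : Set X

instance (X : Type u) : Category (SubsetCat X) where
  Hom A B := A.carrier → B.carrier
  id _ := fun x => x
  comp f g := fun x => g (f x)

section Dual

variable {C : Type u} [Category.{v} C] [HasInclusions C] [FactorizationCategory C]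

/-- The set `H(ε;d) = {ε * f° : f ∈ C(c, d)}`, where `c` is the vertex of `ε`. -/
def Hset {c : C} (ε : ConeAt c) (d : C) : Set (Cones C) :=
  {γ | ∃ f : c ⟶ d, γ = ε.star f}

theorem ConeAt.IsIdem.recover {c d : C} {ε : ConeAt c} (hε : ε.IsIdem) (f : c ⟶ d)
    (γ : Cones C) (h : γ = ε.star f) :
    ∃ j : γ.1 ⟶ d, IsIncl j ∧ γ.2.app c ≫ j = f := by
  subst h
  refine ⟨imIncl f, isIncl_imIncl f, ?_⟩
  change (ε.app c ≫ epiPart f) ≫ imIncl f = f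
  rw [ε.isIdem_iff.1 hε, Category.id_comp, epiPart_imIncl]

theorem ConeAt.IsIdem.star_injective {c d : C} {ε : ConeAt c} (hε : ε.IsIdem) {f g : c ⟶ d}
    (h : ε.star f = ε.star g) : f = g := by
  obtain ⟨j, hj, hjf⟩ := hε.recover f _ rfl
  obtain ⟨j', hj', hjg⟩ := hε.recover g _ h
  rw [← hjf, ← hjg, CategoryWithSubobjects.incl_unique _ _ hj hj']

/-- The bijection `η : H(ε;d) → C(c, d)`, `ε * f° ↦ f`. -/
noncomputable def eta {c d : C} {ε : ConeAt c} (γ : Hset ε d) : c ⟶ d := γ.2.choose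

theorem star_eta {c d : C} {ε : ConeAt c} (γ : Hset ε d) : ε.star (eta γ) = γ.1 :=
  γ.2.choose_spec.symm

theorem eta_star {c d : C} {ε : ConeAt c} (hε : ε.IsIdem) (f : c ⟶ d)
    (h : ε.star f ∈ Hset ε d) : eta ⟨ε.star f, h⟩ = f :=
  hε.star_injective (star_eta ⟨ε.star f, h⟩)

/-- The function `H(ε;g) : H(ε;d) → H(ε;d')`, `ε * f° ↦ ε * (f g)°`. -/
noncomputable def HsetMap {c d d' : C} (ε : ConeAt c) (g : d ⟶ d') (γ : Hset ε d) : Hset ε d' :=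
  ⟨ε.star (eta γ ≫ g), _, rfl⟩

/-- The function `η_ε C(k,-) η_ε'⁻¹ : H(ε;d) → H(ε';d)`, `ε * f° ↦ ε' * (k f)°`. -/
noncomputable def HsetTrans {c c' d : C} {ε : ConeAt c} (ε' : ConeAt c') (k : c' ⟶ c)
    (γ : Hset ε d) : Hset ε' d :=
  ⟨ε'.star (k ≫ eta γ), _, rfl⟩

theorem eta_HsetMap {c d d' : C} {ε : ConeAt c} (hε : ε.IsIdem) (g : d ⟶ d') (γ : Hset ε d) :
    eta (HsetMap ε g γ) = eta γ ≫ g := eta_star hε _ _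

theorem eta_HsetTrans {c c' d : C} {ε : ConeAt c} {ε' : ConeAt c'} (hε' : ε'.IsIdem)
    (k : c' ⟶ c) (γ : Hset ε d) : eta (HsetTrans ε' k γ) = k ≫ eta γ := eta_star hε' _ _

theorem eta_injective {c d : C} {ε : ConeAt c} {γ γ' : Hset ε d} (h : eta γ = eta γ') :
    γ = γ' := by
  apply Subtype.ext
  rw [← star_eta γ, ← star_eta γ', h]

/-- The `H`-functor `H(ε;-)`. -/
noncomputable def H {c : C} (ε : ConeAt c) (hε : ε.IsIdem) : C ⥤ SubsetCat (Cones C) where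
  obj d := ⟨Hset ε d⟩
  map g := HsetMap ε g
  map_id d := funext fun (γ : Hset ε d) =>
    show HsetMap ε (𝟙 d) γ = γ from
    eta_injective (by rw [eta_HsetMap hε, Category.comp_id])
  map_comp {d _ _} f g := funext fun (γ : Hset ε d) =>
    show HsetMap ε (f ≫ g) γ = HsetMap ε g (HsetMap ε f γ) from
    eta_injective (by rw [eta_HsetMap hε, eta_HsetMap hε, eta_HsetMap hε, Category.assoc])

/-- The natural transformation `η_ε C(k,-) η_ε'⁻¹ : H(ε;-) ⟶ H(ε';-)`. -/
noncomputable def Hmap {c c' : C} {ε : ConeAt c} {ε' : ConeAt c'} (hε : ε.IsIdem)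
    (hε' : ε'.IsIdem) (k : c' ⟶ c) : H ε hε ⟶ H ε' hε' where
  app _ := HsetTrans ε' k
  naturality d d' g := funext fun (γ : Hset ε d) =>
    show HsetTrans ε' k (HsetMap ε g γ) = HsetMap ε' g (HsetTrans ε' k γ) from
    eta_injective (by rw [eta_HsetTrans hε', eta_HsetMap hε, eta_HsetMap hε', eta_HsetTrans hε',
      Category.assoc])

theorem Hmap_id {c : C} {ε : ConeAt c} (hε : ε.IsIdem) :
    Hmap hε hε (𝟙 c) = 𝟙 (H ε hε) :=
  NatTrans.ext (funext fun d => funext fun (γ : Hset ε d) =>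
    show HsetTrans ε (𝟙 c) γ = γ from
    eta_injective (by rw [eta_HsetTrans hε, Category.id_comp]))

theorem Hmap_comp {c c' c'' : C} {ε : ConeAt c} {ε' : ConeAt c'} {ε'' : ConeAt c''}
    (hε : ε.IsIdem) (hε' : ε'.IsIdem) (hε'' : ε''.IsIdem) (k : c' ⟶ c) (k' : c'' ⟶ c') :
    Hmap hε hε' k ≫ Hmap hε' hε'' k' = Hmap hε hε'' (k' ≫ k) :=
  NatTrans.ext (funext fun d => funext fun (γ : Hset ε d) =>
    show HsetTrans ε'' k' (HsetTrans ε' k γ) = HsetTrans ε'' (k' ≫ k) γ from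
    eta_injective (by rw [eta_HsetTrans hε'', eta_HsetTrans hε', eta_HsetTrans hε'',
      Category.assoc]))

variable (C) in
/-- The objects of the consistent dual: the `H`-functors. -/
structure Dual where
  functor : C ⥤ SubsetCat (Cones C)
  isH : ∃ (c : C) (ε : ConeAt c) (hε : ε.IsIdem), functor = H ε hε

/-- The consistent dual: the full subcategory of the functor category formed by the
`H`-functors. -/
instance : Category (Dual C) where
  Hom F G := F.functor ⟶ G.functor
  id F := 𝟙 F.functor
  comp f g := NatTrans.vcomp f g

/-- The inclusions of the dual: natural transformations all of whose components are inclusions of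
sets. -/
instance : HasInclusions (Dual C) where
  IsIncl {F G} τ := ∀ (c : C) (γ : (F.functor.obj c).carrier),
    (NatTrans.app (F := F.functor) (G := G.functor) τ c γ : Cones C) = γ

/-- `ε` is an idempotent cone (with vertex `c`) such that `F = H(ε;-)`. -/
def Represents (F : Dual C) {c : C} (ε : ConeAt c) : Prop :=
  ∃ hε : ε.IsIdem, F.functor = H ε hε

/-- The `M`-set of `F = H(ε;-)`: the objects `c` such that `ε(c)` is an isomorphism. -/
def MSet (F : Dual C) : Set C :=
  {c | ∃ (d : C) (ε : ConeAt d), Represents F ε ∧ IsIso (ε.app c)}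

end Dual

/-! ### Cross-connections -/

/-- Local isomorphisms: inclusion preserving, fully faithful functors which restrict to
isomorphisms `⟨c⟩ → ⟨F c⟩`, that is, bijections on objects and on morphisms. -/
structure IsLocalIso {C : Type u} [Category.{v} C] [HasInclusions C] {D : Type u'}
    [Category.{v'} D] [HasInclusions D] (F : C ⥤ D) : Prop where
  map_incl : ∀ {a b : C} (j : a ⟶ b), IsIncl j → IsIncl (F.map j)
  full : F.Full
  faithful : F.Faithful
  obj_bij : ∀ (c : C), Set.BijOn F.obj {a | Sub a c} {x | Sub x (F.obj c)}
  hom_bij : ∀ (c a b : C), Sub a c → Sub b c →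
    Set.BijOn (fun f : a ⟶ b => F.map f) {f | InCore c f} {g | InCore (F.obj c) g}

section CrossConnection

variable {C D : Type u} [Category.{v} C] [HasInclusions C] [FactorizationCategory C]
  [Category.{v} D] [HasInclusions D] [FactorizationCategory D]

variable (C D) in
/-- The two functors of a cross-connection. -/
structure CrossData where
  Γ : D ⥤ Dual C
  Δ : C ⥤ Dual D

namespace CrossData

/-- `(C, D; Γ, Δ)` is a cross-connection between the consistent categories `C` and `D`. -/
structure IsCrossConnection (Ω : CrossData C D) : Prop where
  left : IsConsistentCategory C
  right : IsConsistentCategory D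
  localIso_Γ : IsLocalIso Ω.Γ
  localIso_Δ : IsLocalIso Ω.Δ
  mem_iff : ∀ (c : C) (d : D), c ∈ MSet (Ω.Γ.obj d) ↔ d ∈ MSet (Ω.Δ.obj c)

/-- `γ` is the idempotent cone `γ(c,d)`: it has vertex `c`, and `H(γ;-) = Γ(d)`. -/
def IsGamma (Ω : CrossData C D) (c : C) (d : D) (γ : ConeAt c) : Prop :=
  Represents (Ω.Γ.obj d) γ

/-- `δ` is the idempotent cone `δ(c,d)`: it has vertex `d`, and `H(δ;-) = Δ(c)`. -/
def IsDelta (Ω : CrossData C D) (c : C) (d : D) (δ : ConeAt d) : Prop :=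
  Represents (Ω.Δ.obj c) δ

/-- `g : d₂ ⟶ d₁` is the transpose of `f : c₁ ⟶ c₂` relative to `(c₁, d₁)` and `(c₂, d₂)`: with
`δᵢ = δ(cᵢ,dᵢ)`, one has `Δ(f) η_δ₂ = η_δ₁ D(g,-)`, so that `Δ(f)` maps `δ₁ * h°` to
`δ₂ * (g h)°`. -/
def IsTranspose (Ω : CrossData C D) {c₁ c₂ : C} {d₁ d₂ : D} (f : c₁ ⟶ c₂) (g : d₂ ⟶ d₁) : Prop :=
  ∃ (δ₁ : ConeAt d₁) (δ₂ : ConeAt d₂), Ω.IsDelta c₁ d₁ δ₁ ∧ Ω.IsDelta c₂ d₂ δ₂ ∧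
    ∀ (d : D) (h : d₁ ⟶ d) (x : ((Ω.Δ.obj c₁).functor.obj d).carrier), x.1 = δ₁.star h →
      (NatTrans.app (F := (Ω.Δ.obj c₁).functor) (G := (Ω.Δ.obj c₂).functor) (Ω.Δ.map f) d x
        : Cones D) = δ₂.star (g ≫ h)

/-- The bijection `χ(c,d) : Γ(c,d) → Δ(c,d)`, as a relation: it relates `γ(c',d) * f°` to
`δ(c,d') * g°` whenever `g : d' ⟶ d` is the transpose of `f : c' ⟶ c`. -/
def Chi (Ω : CrossData C D) (c : C) (d : D) (γ : Cones C) (δ : Cones D) : Prop :=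
  ∃ (c' : C) (d' : D) (f : c' ⟶ c) (g : d' ⟶ d) (γ₀ : ConeAt c') (δ₀ : ConeAt d'),
    Ω.IsGamma c' d γ₀ ∧ Ω.IsDelta c d' δ₀ ∧ Ω.IsTranspose f g ∧ γ = γ₀.star f ∧ δ = δ₀.star g

/-- The set of linked pairs, in the semigroup of all pairs of consistent cones with the operation
`(γ, δ) (γ', δ') = (γ γ', δ' δ)`. -/
def linked (Ω : CrossData C D) : Set (Cones C × (Cones D)ᵐᵒᵖ) :=
  {p | ∃ (c : C) (d : D), Ω.Chi c d p.1 p.2.unop}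

/-- The cross-connection semigroup `𝕊Ω`: the linked pairs, with the operation
`(γ, δ) (γ', δ') = (γ γ', δ' δ)`. -/
def crossSemigroup (Ω : CrossData C D)
    (h : ∀ p ∈ Ω.linked, ∀ q ∈ Ω.linked, p * q ∈ Ω.linked) :
    Subsemigroup (Cones C × (Cones D)ᵐᵒᵖ) where
  carrier := Ω.linked
  mul_mem' hp hq := h _ hp _ hq

variable {C' D' : Type u} [Category.{v} C'] [HasInclusions C'] [FactorizationCategory C']
  [Category.{v} D'] [HasInclusions D'] [FactorizationCategory D']

/-- The pair of functors `(F, G)` is a morphism of cross-connections. -/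
structure IsCCMorphism (Ω : CrossData C D) (Ω' : CrossData C' D') (F : C ⥤ C') (G : D ⥤ D') :
    Prop where
  left_incl : ∀ {a b : C} (j : a ⟶ b), IsIncl j → IsIncl (F.map j)
  left_bimorphism : ∀ {a b : C} (u : a ⟶ b), IsBimorphism u → IsBimorphism (F.map u)
  right_incl : ∀ {a b : D} (j : a ⟶ b), IsIncl j → IsIncl (G.map j)
  right_bimorphism : ∀ {a b : D} (u : a ⟶ b), IsBimorphism u → IsBimorphism (G.map u)
  mem : ∀ (c : C) (d : D), c ∈ MSet (Ω.Γ.obj d) → F.obj c ∈ MSet (Ω'.Γ.obj (G.obj d))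
  map_gamma : ∀ (c : C) (d : D) (γ : ConeAt c) (γ' : ConeAt (F.obj c)), Ω.IsGamma c d γ →
    Ω'.IsGamma (F.obj c) (G.obj d) γ' → ∀ a : C, F.map (γ.app a) = γ'.app (F.obj a)
  transpose : ∀ {c₁ c₂ : C} {d₁ d₂ : D} (f : c₁ ⟶ c₂) (g : d₂ ⟶ d₁), Ω.IsTranspose f g →
    Ω'.IsTranspose (F.map f) (G.map g)

/-- The graph of the map `𝕊m : 𝕊Ω → 𝕊Ω'` induced by `m = (F, G)`: it sends
`(γ(c',d) * u, δ(c,d') * v)`, where `u : c' ⟶ c` is a bimorphism with transpose `v : d' ⟶ d`, to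
`(γ(F c',G d) * F u, δ(F c,G d') * G v)`. -/
def MapsTo (Ω : CrossData C D) (Ω' : CrossData C' D') (F : C ⥤ C') (G : D ⥤ D')
    (p : Cones C × (Cones D)ᵐᵒᵖ) (p' : Cones C' × (Cones D')ᵐᵒᵖ) : Prop :=
  ∃ (c c' : C) (d d' : D) (u : c' ⟶ c) (v : d' ⟶ d) (γ : ConeAt c') (δ : ConeAt d')
    (γ' : ConeAt (F.obj c')) (δ' : ConeAt (G.obj d')),
    IsBimorphism u ∧ Ω.IsTranspose u v ∧ Ω.IsGamma c' d γ ∧ Ω.IsDelta c d' δ ∧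
    Ω'.IsGamma (F.obj c') (G.obj d) γ' ∧ Ω'.IsDelta (F.obj c) (G.obj d') δ' ∧
    p = (γ.star u, op (δ.star v)) ∧ p' = (γ'.star (F.map u), op (δ'.star (G.map v)))

end CrossData

end CrossConnection

/-! ### The category of principal left ideals -/

section LeftIdeals

/-- The principal left ideal `S e` (for `e` idempotent). -/
def leftIdeal {S : Type u} [Semigroup S] (e : S) : Set S := {x | ∃ s, x = s * e}

theorem mem_leftIdeal {S : Type u} [Semigroup S] {e : S} (he : IsIdempotentElem e) {x : S} :
    x ∈ leftIdeal e ↔ x * e = x := by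
  constructor
  · rintro ⟨s, rfl⟩
    rw [mul_assoc, he.eq]
  · intro h
    exact ⟨x, h.symm⟩

/-- The objects of `𝕃(S)`: the principal left ideals generated by idempotents. -/
structure LObj (S : Type u) [Semigroup S] where
  carrier : Set S
  exists_gen : ∃ e : S, IsIdempotentElem e ∧ carrier = leftIdeal e

variable {S : Type u} [Semigroup S]

/-- The object `S e` of `𝕃(S)`. -/
def LObj.of (e : S) (he : IsIdempotentElem e) : LObj S := ⟨leftIdeal e, e, he, rfl⟩

theorem LObj.mem_of {e x : S} {he : IsIdempotentElem e} :
    x ∈ (LObj.of e he).carrier ↔ x * e = x := mem_leftIdeal he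

/-- An idempotent `e` with `A = S e`. -/
noncomputable def LObj.gen (A : LObj S) : S := A.exists_gen.choose

theorem LObj.gen_idem (A : LObj S) : IsIdempotentElem A.gen := A.exists_gen.choose_spec.1

theorem LObj.carrier_eq (A : LObj S) : A.carrier = leftIdeal A.gen := A.exists_gen.choose_spec.2

theorem LObj.mem_iff (A : LObj S) {x : S} : x ∈ A.carrier ↔ x * A.gen = x := by
  rw [A.carrier_eq, mem_leftIdeal A.gen_idem]

theorem LObj.gen_mem (A : LObj S) : A.gen ∈ A.carrier := A.mem_iff.2 A.gen_idem

theorem LObj.mul_mem (A : LObj S) (s : S) {x : S} (hx : x ∈ A.carrier) : s * x ∈ A.carrier := by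
  rw [A.mem_iff] at hx ⊢
  rw [mul_assoc, hx]

/-- The category `𝕃(S)`. The morphisms from `A = S e` to `B = S f` are the functions
`ρ(e,u,f) : x ↦ x u`; replacing `u` by `e u`, which lies in `S f`, one may take `u ∈ e S f`. -/
instance : Category (LObj S) where
  Hom A B := {φ : A.carrier → B.carrier // ∃ u : S, ∀ x, (φ x : S) = x * u}
  id A := ⟨fun x => x, A.gen, fun x => (A.mem_iff.1 x.2).symm⟩
  comp φ ψ := ⟨fun x => ψ.1 (φ.1 x), by
    obtain ⟨u, hu⟩ := φ.2
    obtain ⟨v, hv⟩ := ψ.2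
    exact ⟨u * v, fun x => by rw [hv, hu, mul_assoc]⟩⟩

/-- The morphism `x ↦ x u` from `A` to `B`. -/
def rho {A B : LObj S} (u : S) (h : ∀ x ∈ A.carrier, x * u ∈ B.carrier) : A ⟶ B :=
  ⟨fun x => ⟨x * u, h x x.2⟩, u, fun _ => rfl⟩

/-- The image of `x ∈ A` under `φ : A ⟶ B`. -/
def LObj.apply {A B : LObj S} (φ : A ⟶ B) (x : A.carrier) : B.carrier := φ.1 x

theorem LObj.hom_ext {A B : LObj S} {φ ψ : A ⟶ B}
    (h : ∀ x : A.carrier, (LObj.apply φ x : S) = LObj.apply ψ x) : φ = ψ :=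
  Subtype.ext (funext fun x => Subtype.ext (h x))

theorem LObj.apply_rho {A B : LObj S} (u : S) (h : ∀ x ∈ A.carrier, x * u ∈ B.carrier)
    (x : A.carrier) : (LObj.apply (rho (B := B) u h) x : S) = x * u := rfl

theorem LObj.apply_comp {A B B' : LObj S} (φ : A ⟶ B) (ψ : B ⟶ B') (x : A.carrier) :
    LObj.apply (φ ≫ ψ) x = LObj.apply ψ (LObj.apply φ x) := rfl

theorem LObj.apply_id (A : LObj S) (x : A.carrier) : LObj.apply (𝟙 A) x = x := rfl

/-- The element `u ∈ e S f` such that `φ = ρ(e,u,f)`, where `e` is the chosen generator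
of `A`. -/
noncomputable def LObj.coef {A B : LObj S} (φ : A ⟶ B) : S :=
  (LObj.apply φ ⟨A.gen, A.gen_mem⟩ : B.carrier)

theorem LObj.coef_mem {A B : LObj S} (φ : A ⟶ B) : LObj.coef φ ∈ B.carrier :=
  (LObj.apply φ ⟨A.gen, A.gen_mem⟩).2

theorem LObj.apply_eq {A B : LObj S} (φ : A ⟶ B) (x : A.carrier) :
    (LObj.apply φ x : S) = x * LObj.coef φ := by
  obtain ⟨u, hu⟩ := φ.2
  have h1 : (LObj.apply φ x : S) = x * u := hu x
  have h2 : LObj.coef φ = A.gen * u := hu ⟨A.gen, A.gen_mem⟩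
  rw [h1, h2, ← mul_assoc, A.mem_iff.1 x.2]

theorem LObj.gen_mul_coef {A B : LObj S} (φ : A ⟶ B) : A.gen * LObj.coef φ = LObj.coef φ :=
  (LObj.apply_eq φ ⟨A.gen, A.gen_mem⟩).symm

/-- The inclusions of `𝕃(S)` are the inclusions of left ideals. -/
instance : HasInclusions (LObj S) where
  IsIncl φ := ∀ x, (LObj.apply φ x : S) = x

instance : CategoryWithSubobjects (LObj S) where
  incl_id _ _ := rfl
  incl_comp f g hf hg x := by
    rw [LObj.apply_comp]
    exact (hg _).trans (hf x)
  incl_unique f g hf hg := LObj.hom_ext fun x => (hf x).trans (hg x).symm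
  incl_antisymm {A B} f g hf hg := by
    have h1 : A.carrier = B.carrier := by
      apply Set.Subset.antisymm
      · intro x hx
        have := (LObj.apply f ⟨x, hx⟩).2
        rwa [hf ⟨x, hx⟩] at this
      · intro x hx
        have := (LObj.apply g ⟨x, hx⟩).2
        rwa [hg ⟨x, hx⟩] at this
    cases A; cases B
    cases h1
    rfl
  incl_mono f hf := ⟨fun g h hgh => LObj.hom_ext fun x => by
    have h1 := congrArg (fun φ => (LObj.apply φ x : S)) hgh
    simp only [LObj.apply_comp] at h1
    rwa [hf, hf] at h1⟩
  incl_of_comp h g hg hhg x := by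
    have h1 := hhg x
    rw [LObj.apply_comp] at h1
    rwa [hg] at h1

/-- `ρ(g,u,h)` is a bimorphism if `g R* u` and `u L* h`. -/
theorem isBimorphism_rho {A B : LObj S} {g u k : S} (hg : IsIdempotentElem g)
    (hA : A.carrier = leftIdeal g) (hB : B.carrier = leftIdeal k) (hgu : RStar u g)
    (hku : LStar u k) (hk : IsIdempotentElem k)
    (h : ∀ x ∈ A.carrier, x * u ∈ B.carrier) : IsBimorphism (rho (A := A) (B := B) u h) := by
  constructor
  · refine ⟨fun φ ψ hφψ => LObj.hom_ext fun x => ?_⟩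
    have h1 : (LObj.apply φ x : S) * u = (LObj.apply ψ x : S) * u :=
      congrArg (fun φ => (LObj.apply φ x : S)) hφψ
    have h2 := hgu.cancel h1
    have h3 : ∀ y : A.carrier, (y : S) * g = y := fun y =>
      (mem_leftIdeal hg).1 (hA ▸ y.2)
    rwa [h3, h3] at h2
  · refine ⟨fun {E} φ ψ hφψ => LObj.hom_ext fun x => ?_⟩
    have hgA : g ∈ A.carrier := by rw [hA, mem_leftIdeal hg]; exact hg
    have h1 : (LObj.apply φ (LObj.apply (rho (B := B) u h) ⟨g, hgA⟩) : S) =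
        LObj.apply ψ (LObj.apply (rho (B := B) u h) ⟨g, hgA⟩) :=
      congrArg (fun φ => (LObj.apply φ ⟨g, hgA⟩ : S)) hφψ
    rw [LObj.apply_eq φ, LObj.apply_eq ψ, LObj.apply_rho, hgu.eq_mul hg] at h1
    have h2 := hku.cancel h1
    have h3 : (x : S) * k = x := (mem_leftIdeal hk).1 (hB ▸ x.2)
    rw [LObj.apply_eq, LObj.apply_eq, ← h3, mul_assoc, mul_assoc, h2]

instance [Abundant S] : FactorizationCategory (LObj S) where
  split {A B} j hj := by
    have hAB : ∀ x ∈ A.carrier, x ∈ B.carrier := fun x hx => by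
      have := (LObj.apply j ⟨x, hx⟩).2
      rwa [hj ⟨x, hx⟩] at this
    refine ⟨rho A.gen fun x _ => A.mul_mem x A.gen_mem, LObj.hom_ext fun x => ?_⟩
    rw [LObj.apply_comp, LObj.apply_rho, hj, LObj.apply_id, A.mem_iff.1 x.2]
  factor {A B} f := by
    set u := LObj.coef f with hu
    obtain ⟨g', hg', hgu⟩ := Abundant.exists_rstar u
    obtain ⟨k, hk, hku⟩ := Abundant.exists_lstar u
    have h1 : A.gen * g' = g' := by
      have := hgu.cancel (x := A.gen) (y := g')
        (by rw [hgu.eq_mul hg', hu, LObj.gen_mul_coef])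
      rw [this, hg'.eq]
    have hg : IsIdempotentElem (g' * A.gen) := by
      change g' * A.gen * (g' * A.gen) = g' * A.gen
      rw [← mul_assoc, mul_assoc g', h1, hg'.eq]
    have hgu2 : (g' * A.gen) * u = u := by
      rw [mul_assoc, hu, LObj.gen_mul_coef, ← hu, hgu.eq_mul hg']
    have hkB : k * B.gen = k := by
      have := hku.cancel (x := B.gen) (y := k)
        (by rw [hku.mul_eq hk, ← B.mem_iff]; exact LObj.coef_mem f)
      rw [this, hk.eq]
    have hgu' : RStar u (g' * A.gen) := by
      obtain ⟨T, _, i, hi, h2, h3⟩ := hgu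
      refine ⟨T, inferInstance, i, hi, Or.inr ⟨i u, by rw [← map_mul, hgu2]⟩, Or.inr ?_⟩
      rcases h3 with h3 | ⟨s, h3⟩
      · exact ⟨i A.gen, by rw [map_mul, h3]⟩
      · exact ⟨s * i A.gen, by rw [map_mul, h3, mul_assoc]⟩
    let G : LObj S := LObj.of (g' * A.gen) hg
    let K : LObj S := LObj.of k hk
    have hGA : ∀ x ∈ G.carrier, x ∈ A.carrier := by
      rintro x ⟨s, rfl⟩
      exact A.mul_mem _ (A.mul_mem _ A.gen_mem)
    refine ⟨⟨G, K, rho (g' * A.gen) fun x _ => LObj.mem_of.2 (by rw [mul_assoc, hg.eq]),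
      rho u fun x _ => LObj.mem_of.2 (by rw [mul_assoc, hku.mul_eq hk]),
      rho k fun x hx => by
        rw [B.mem_iff, mul_assoc, hkB], ?_, ?_, ?_, ?_⟩⟩
    · refine ⟨rho A.gen fun x _ => A.mul_mem x A.gen_mem, fun x => ?_,
        LObj.hom_ext fun x => ?_⟩
      · rw [LObj.apply_rho]
        exact A.mem_iff.1 (hGA _ x.2)
      · rw [LObj.apply_comp, LObj.apply_rho, LObj.apply_rho, LObj.apply_id,
          A.mem_iff.1 (hGA _ x.2)]
        exact (mem_leftIdeal hg).1 x.2
    · exact isBimorphism_rho hg rfl rfl hgu' hku hk _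
    · intro x
      rw [LObj.apply_rho]
      exact (mem_leftIdeal hk).1 x.2
    · refine LObj.hom_ext fun x => ?_
      rw [LObj.apply_comp, LObj.apply_comp, LObj.apply_rho, LObj.apply_rho, LObj.apply_rho,
        LObj.apply_eq, mul_assoc, mul_assoc, hku.mul_eq hk, hgu2]

variable [Abundant S]

/-- An idempotent `f` with `a L* f`. -/
noncomputable def lstarIdem (a : S) : S := (Abundant.exists_lstar a).choose

theorem lstarIdem_idem (a : S) : IsIdempotentElem (lstarIdem a) :=
  (Abundant.exists_lstar a).choose_spec.1

theorem lstar_lstarIdem (a : S) : LStar a (lstarIdem a) := (Abundant.exists_lstar a).choose_spec.2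

/-- The vertex `S f` of the principal cone `ρᵃ`, where `a L* f`. -/
noncomputable def coneVertex (a : S) : LObj S := LObj.of (lstarIdem a) (lstarIdem_idem a)

/-- The vertex does not depend on the choice of `f`. -/
theorem coneVertex_eq {a f : S} (hf : IsIdempotentElem f) (h : LStar a f) :
    coneVertex a = LObj.of f hf := by
  have h1 : lstarIdem a * f = lstarIdem a := by
    have := (lstar_lstarIdem a).cancel (x := f) (y := lstarIdem a)
      (by rw [h.mul_eq hf, (lstar_lstarIdem a).mul_eq (lstarIdem_idem a)])
    rw [this, (lstarIdem_idem a).eq]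
  have h2 : f * lstarIdem a = f := by
    have := h.cancel (x := lstarIdem a) (y := f)
      (by rw [h.mul_eq hf, (lstar_lstarIdem a).mul_eq (lstarIdem_idem a)])
    rw [this, hf.eq]
  have h3 : leftIdeal (lstarIdem a) = leftIdeal f := by
    ext x
    rw [mem_leftIdeal (lstarIdem_idem a), mem_leftIdeal hf]
    constructor
    · intro hx; rw [← hx, mul_assoc, h1]
    · intro hx; rw [← hx, mul_assoc, h2]
  simp only [coneVertex, LObj.of, h3]

/-- The principal cone `ρᵃ` in `𝕃(S)`: its component at `S e` is `x ↦ x a`, that is,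
`ρ(e, e a, f)` with `a L* f`. -/
noncomputable def principalCone (a : S) : ConeAt (coneVertex a) where
  app A := rho a fun x _ => LObj.mem_of.2
    (by rw [mul_assoc, (lstar_lstarIdem a).mul_eq (lstarIdem_idem a)])
  compat j hj := LObj.hom_ext fun x => by
    change (LObj.apply j x : S) * a = x * a
    rw [hj]
  exists_bimorphism := by
    obtain ⟨g, hg, hga⟩ := Abundant.exists_rstar a
    exact ⟨LObj.of g hg, isBimorphism_rho hg rfl rfl hga (lstar_lstarIdem a)
      (lstarIdem_idem a) _⟩

theorem coneVertex_carrier {e : S} (he : IsIdempotentElem e) :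
    (coneVertex e).carrier = leftIdeal e := by
  have h : LStar e e := ⟨S, inferInstance, MulHom.id S, fun _ _ h => h, Or.inl rfl, Or.inl rfl⟩
  rw [coneVertex_eq he h]
  rfl

theorem principalCone_isIdem {e : S} (he : IsIdempotentElem e) :
    (principalCone e).IsIdem := by
  rw [ConeAt.isIdem_iff]
  refine LObj.hom_ext fun x => ?_
  have hx : (x : S) ∈ leftIdeal e := coneVertex_carrier he ▸ x.2
  change (x : S) * e = x
  exact (mem_leftIdeal he).1 hx

end LeftIdeals

/-! ### The cross-connection of a concordant semigroup -/

section Omega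

/-- Let `t` be an anti-isomorphism from `T` onto `S`, so that `𝕃(T)` is the category `ℝ(S)` of
principal right ideals of `S`. This is the functor `Γ_S : ℝ(S) ⥤ 𝕃(S)*` which sends `e S` to
`H(ρᵉ;-)` and `λ(e,u,f)` to `η_{ρᵉ} 𝕃(S)(ρ(f,u,e),-) η_{ρᶠ}⁻¹` (for a chosen generator `e` of
each object; the result does not depend on the choice). -/
noncomputable def gammaFunctor {S T : Type u} [Semigroup S] [Abundant S] [Semigroup T]
    (t : T ≃ S) (ht : ∀ x y, t (x * y) = t y * t x) : LObj T ⥤ Dual (LObj S) :=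
  have hid : ∀ A : LObj T, IsIdempotentElem (t A.gen) := fun A => by
    change t A.gen * t A.gen = t A.gen
    rw [← ht, A.gen_idem.eq]
  have hmem : ∀ {A B : LObj T} (φ : A ⟶ B), ∀ x ∈ (coneVertex (t B.gen)).carrier,
      x * t (LObj.coef φ) ∈ (coneVertex (t A.gen)).carrier := fun {A B} φ x _ => by
    rw [coneVertex_carrier (hid A), mem_leftIdeal (hid A), mul_assoc, ← ht, LObj.gen_mul_coef]
  { obj := fun A => ⟨H (principalCone (t A.gen)) (principalCone_isIdem (hid A)), _, _, _, rfl⟩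
    map := fun {A B} φ => Hmap (principalCone_isIdem (hid A)) (principalCone_isIdem (hid B))
      (rho (t (LObj.coef φ)) (hmem φ))
    map_id := fun A => by
      refine Eq.trans ?_ (Hmap_id (principalCone_isIdem (hid A)))
      congr 1
      refine LObj.hom_ext fun x => ?_
      rw [LObj.apply_rho, LObj.apply_id]
      have hx : (x : S) ∈ leftIdeal (t A.gen) := coneVertex_carrier (hid A) ▸ x.2
      exact (mem_leftIdeal (hid A)).1 hx
    map_comp := fun {A B E} φ ψ => by
      refine Eq.trans ?_ (Hmap_comp (principalCone_isIdem (hid A)) (principalCone_isIdem (hid B))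
        (principalCone_isIdem (hid E)) (rho (t (LObj.coef φ)) (hmem φ))
        (rho (t (LObj.coef ψ)) (hmem ψ))).symm
      congr 1
      refine LObj.hom_ext fun x => ?_
      rw [LObj.apply_comp, LObj.apply_rho, LObj.apply_rho, LObj.apply_rho, mul_assoc, ← ht]
      congr 2
      exact LObj.apply_eq ψ (LObj.apply φ ⟨A.gen, A.gen_mem⟩) }

/-- The category `ℝ(S)` of principal right ideals: it is the category `𝕃` of the opposite
semigroup, with `e S = Sᵒᵖ e` and `λ(e,u,f) : x ↦ u x`, `u ∈ f S e`. -/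
abbrev RObj (S : Type u) [Semigroup S] : Type u := LObj Sᵐᵒᵖ

/-- The principal cone `λᵃ` in `ℝ(S)`. -/
noncomputable def principalConeR {S : Type u} [Semigroup S] [Abundant S] (a : S) :
    ConeAt (coneVertex (op a)) := principalCone (op a)

/-- The cross-connection `ΩS = (𝕃(S), ℝ(S); Γ_S, Δ_S)`. -/
noncomputable def Omega (S : Type u) [Semigroup S] [Abundant S] :
    CrossData (LObj S) (RObj S) where
  Γ := gammaFunctor (S := S) (T := Sᵐᵒᵖ) opEquiv.symm fun _ _ => rfl
  Δ := gammaFunctor (S := Sᵐᵒᵖ) (T := S) opEquiv fun _ _ => rfl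

/-- The pair `(ρᵃ, λᵃ)`. -/
noncomputable def principalPair {S : Type u} [Semigroup S] [Abundant S] (a : S) :
    Cones (LObj S) × (Cones (RObj S))ᵐᵒᵖ :=
  (⟨coneVertex a, principalCone a⟩, op ⟨coneVertex (op a), principalConeR a⟩)

/-- The functor `F_h : 𝕃(S) ⥤ 𝕃(T)` of a homomorphism `h : S → T`, which sends `S e` to `T (e h)`
and `ρ(e,u,f)` to `ρ(e h, u h, f h)` (for a chosen generator `e` of each object; the result does not
depend on the choice). -/
noncomputable def leftMap {S T : Type u} [Semigroup S] [Semigroup T] (h : S →ₙ* T) :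
    LObj S ⥤ LObj T :=
  have hid : ∀ A : LObj S, IsIdempotentElem (h A.gen) := fun A => by
    change h A.gen * h A.gen = h A.gen
    rw [← map_mul, A.gen_idem.eq]
  { obj := fun A => LObj.of (h A.gen) (hid A)
    map := fun {A B} φ => rho (h (LObj.coef φ)) fun x _ => LObj.mem_of.2 (by
      rw [mul_assoc, ← map_mul, B.mem_iff.1 (LObj.coef_mem φ)])
    map_id := fun A => LObj.hom_ext fun x => (mem_leftIdeal (hid A)).1 x.2
    map_comp := fun {A B E} φ ψ => LObj.hom_ext fun x => by
      rw [LObj.apply_comp, LObj.apply_rho, LObj.apply_rho, LObj.apply_rho, mul_assoc, ← map_mul]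
      congr 2
      exact LObj.apply_eq ψ (LObj.apply φ ⟨A.gen, A.gen_mem⟩) }

theorem leftMap_obj_of {S T : Type u} [Semigroup S] [Semigroup T] (h : S →ₙ* T) {e : S}
    (he : IsIdempotentElem e) (hhe : IsIdempotentElem (h e)) :
    (leftMap h).obj (LObj.of e he) = LObj.of (h e) hhe := by
  set A := LObj.of e he with hA
  have h1 : A.gen * e = A.gen := LObj.mem_of.1 A.gen_mem
  have h2 : e * A.gen = e := A.mem_iff.1 (LObj.mem_of.2 he)
  have hg : IsIdempotentElem (h A.gen) := by
    change h A.gen * h A.gen = h A.gen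
    rw [← map_mul, A.gen_idem.eq]
  have h3 : leftIdeal (h A.gen) = leftIdeal (h e) := by
    ext x
    rw [mem_leftIdeal hg, mem_leftIdeal hhe]
    constructor
    · intro hx; rw [← hx, mul_assoc, ← map_mul, h1]
    · intro hx; rw [← hx, mul_assoc, ← map_mul, h2]
  change (⟨leftIdeal (h A.gen), _⟩ : LObj T) = ⟨leftIdeal (h e), _⟩
  simp only [h3]

/-- The functor `G_h : ℝ(S) ⥤ ℝ(T)`, which sends `e S` to `(e h) T` and `λ(e,u,f)` to
`λ(e h, u h, f h)`. -/
noncomputable def rightMap {S T : Type u} [Semigroup S] [Semigroup T] (h : S →ₙ* T) :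
    RObj S ⥤ RObj T := leftMap (MulHom.op h)

end Omega

end CrossConnections

open CrossConnections

/-! A morphism of `𝕃(S)` is right multiplication by an element of `S`, so the whole construction can
be unwound into arithmetic in `S`. The pivot is `cones_star_eq`: ρᵃ * g° is the principal cone of
the element g(a). It gives ρᵃ ρᵇ = ρᵃᵇ and, for an idempotent e, identifies H(ρᵉ; D) with eS ∩ D via
w ↦ ρʷ (`mem_Hset_iff`). Thus Γ_S(eS) is essentially the functor D ↦ eS ∩ D, a morphism of `ℝ(S)`
acts on it as itself, and Γ_S is fully faithful by a Yoneda argument, since ρᵉ generates the functor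
(`isLocalIso_gammaFunctor`).

Consistency of `𝕃(S)` uses the axioms of concordance one by one. Bimorphisms are the multiplications
by a with e R* a L* f (`isBimorphism_iff`), and the morphisms of ⟨Se⟩ are the multiplications by
elements of ⟨e⟩ (`inCore_iff`); the connecting bijection ⟨e⟩ → ⟨f⟩ therefore supplies the
isomorphism T. Regularity of products of idempotents supplies normal factorizations. Concordance is
self-dual and `ℝ(S)` is `𝕃` of the opposite semigroup, so every result about `𝕃` also serves for
`ℝ`.

An idempotent k is determined by Sk and kS (`idem_ext`). Hence the pairs in E_Ω correspond to the
idempotents of S, the cone γ(Sk, kS) is ρᵏ, and the transpose of right multiplication by u ∈ k₁Sk₂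
is left multiplication by the same u (`isTranspose_Omega_iff`). So the linked pairs are exactly the
pairs (ρᵘ, λᵘ), and such a pair determines u (`principalPair_injective`): φ(S) is an isomorphism.

Finally the graph of 𝕊Ωh relates (ρᵃ, λᵃ) to the pair of the image of a under h and to nothing else
(`mapsTo_Omega_iff`). So 𝕊Ωh is the conjugate of h by the isomorphisms φ, and concordance, goodness,
functoriality and naturality are transported along φ. -/

namespace CrossConnections

open HasInclusions

/-! ### Idempotents and the relations L* and R*. -/

section Star

variable {S : Type u} [Semigroup S]

/-- The oversemigroup that witnesses u R* g also witnesses u R* e, because g and e are already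
R-related in S. This avoids proving transitivity of R* across different oversemigroups. -/
theorem RStar.of_greenR {u g e : S} (h : RStar u g) (hg : IsIdempotentElem g)
    (h1 : g * e = e) (h2 : e * g = g) : RStar u e := by
  have hu : e * u = u := by rw [← h.eq_mul hg, ← mul_assoc, h2]
  obtain ⟨T, _, i, hi, -, h4⟩ := h
  refine ⟨T, inferInstance, i, hi, Or.inr ⟨i u, by rw [← map_mul, hu]⟩, Or.inr ?_⟩
  rcases h4 with h4 | ⟨s, h4⟩
  · exact ⟨i e, by rw [← h4, ← map_mul, h1]⟩
  · exact ⟨s * i e, by rw [← mul_assoc, ← h4, ← map_mul, h1]⟩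

theorem LStar.of_greenL {u g e : S} (h : LStar u g) (hg : IsIdempotentElem g)
    (h1 : e * g = e) (h2 : g * e = g) : LStar u e := by
  have hu : u * e = u := by rw [← h.mul_eq hg, mul_assoc, h2]
  obtain ⟨T, _, i, hi, -, h4⟩ := h
  refine ⟨T, inferInstance, i, hi, Or.inr ⟨i u, by rw [← map_mul, hu]⟩, Or.inr ?_⟩
  rcases h4 with h4 | ⟨s, h4⟩
  · exact ⟨i e, by rw [← h4, ← map_mul, h1]⟩
  · exact ⟨i e * s, by rw [mul_assoc, ← h4, ← map_mul, h1]⟩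

theorem RStar.idem_mul {u g e : S} (h : RStar u g) (hg : IsIdempotentElem g)
    (he : e * u = u) : e * g = g := by
  rw [h.cancel (x := e) (y := g) (by rw [he, h.eq_mul hg]), hg.eq]

theorem LStar.mul_idem {u g e : S} (h : LStar u g) (hg : IsIdempotentElem g)
    (he : u * e = u) : g * e = g := by
  rw [h.cancel (x := e) (y := g) (by rw [he, h.mul_eq hg]), hg.eq]

/-- In an abundant semigroup no oversemigroup has to be built: some idempotent g is R*-related to u,
and the cancellation condition forces g and e to be R-related. -/
theorem RStar.of_cancel [Abundant S] {u e : S} (he : IsIdempotentElem e) (heu : e * u = u)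
    (h : ∀ x y, x * u = y * u → x * e = y * e) : RStar u e := by
  obtain ⟨g, hg, hgu⟩ := Abundant.exists_rstar u
  refine hgu.of_greenR hg ?_ (hgu.idem_mul hg heu)
  rw [h g e (by rw [heu, hgu.eq_mul hg]), he.eq]

theorem LStar.of_cancel [Abundant S] {u e : S} (he : IsIdempotentElem e) (heu : u * e = u)
    (h : ∀ x y, u * x = u * y → e * x = e * y) : LStar u e := by
  obtain ⟨g, hg, hgu⟩ := Abundant.exists_lstar u
  refine hgu.of_greenL hg ?_ (hgu.mul_idem hg heu)
  rw [h g e (by rw [heu, hgu.mul_eq hg]), he.eq]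

theorem LStar.map_equiv {T : Type u} [Semigroup T] (φ : S ≃* T) {a b : S} (h : LStar a b) :
    LStar (φ a) (φ b) := by
  obtain ⟨U, _, i, hi, h⟩ := h
  refine ⟨U, inferInstance, i.comp φ.symm.toMulHom, hi.comp φ.symm.injective, ?_⟩
  simpa using h

theorem RStar.map_equiv {T : Type u} [Semigroup T] (φ : S ≃* T) {a b : S} (h : RStar a b) :
    RStar (φ a) (φ b) := by
  obtain ⟨U, _, i, hi, h⟩ := h
  refine ⟨U, inferInstance, i.comp φ.symm.toMulHom, hi.comp φ.symm.injective, ?_⟩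
  simpa using h

end Star

/-! ### The connecting relation; concordance of the opposite and of isomorphic semigroups. -/

section OmegaSpan

variable {S : Type u} [Semigroup S]

theorem omegaSpan_mul_right {e x : S} (hx : x ∈ omegaSpan e) : x * e = x := by
  induction hx using Subsemigroup.closure_induction with
  | mem g hg => exact hg.2.1
  | mul x y _ _ _ hy => rw [mul_assoc, hy]

theorem omegaSpan_mul_left {e x : S} (hx : x ∈ omegaSpan e) : e * x = x := by
  induction hx using Subsemigroup.closure_induction with
  | mem g hg => exact hg.2.2
  | mul x y _ _ hx _ => rw [← mul_assoc, hx]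

theorem mem_omegaSpan {e g : S} (hg : IsIdempotentElem g) (h1 : g * e = g) (h2 : e * g = g) :
    g ∈ omegaSpan e :=
  Subsemigroup.subset_closure ⟨hg, h1, h2⟩

/-- For e R e', the element e' is a left identity of ⟨e⟩, so (x e')(y e') = (x y) e'. Right
translation by e' is then multiplicative on ⟨e⟩ and carries generators to generators. -/
theorem omegaSpan_mul_greenR {e e' x : S} (h1 : e * e' = e') (h2 : e' * e = e)
    (hx : x ∈ omegaSpan e) : x * e' ∈ omegaSpan e' := by
  have key : ∀ y ∈ omegaSpan e, e' * y = y := fun y hy => by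
    have := omegaSpan_mul_left hy
    rw [← this, ← mul_assoc, h2]
  induction hx using Subsemigroup.closure_induction with
  | mem g hg =>
    have hk := key g (Subsemigroup.subset_closure hg)
    have he' : e' * e' = e' := by
      nth_rewrite 2 [← h1]; rw [← mul_assoc, h2, h1]
    refine mem_omegaSpan ?_ (by rw [mul_assoc, he']) (by rw [← mul_assoc, hk])
    change g * e' * (g * e') = g * e'
    rw [mul_assoc, ← mul_assoc e', hk, ← mul_assoc, hg.1.eq]
  | mul x y _ hy ihx ihy =>
    have := mul_mem ihx ihy
    rwa [mul_assoc, ← mul_assoc e', key y hy, ← mul_assoc] at this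

theorem omegaSpan_mul_greenL {e e' x : S} (h1 : e' * e = e') (h2 : e * e' = e)
    (hx : x ∈ omegaSpan e) : e' * x ∈ omegaSpan e' := by
  have key : ∀ y ∈ omegaSpan e, y * e' = y := fun y hy => by
    have := omegaSpan_mul_right hy
    rw [← this, mul_assoc, h2]
  induction hx using Subsemigroup.closure_induction with
  | mem g hg =>
    have hk := key g (Subsemigroup.subset_closure hg)
    have he' : e' * e' = e' := by
      nth_rewrite 1 [← h1]; rw [mul_assoc, h2, h1]
    refine mem_omegaSpan ?_ (by rw [mul_assoc, hk]) (by rw [← mul_assoc, he'])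
    change e' * g * (e' * g) = e' * g
    rw [mul_assoc, ← mul_assoc g, hk, hg.1.eq]
  | mul x y hx _ ihx ihy =>
    have := mul_mem ihx ihy
    rwa [mul_assoc, ← mul_assoc x, key x hx] at this

/-- The connecting relation `x a = a y` between `⟨e⟩` and `⟨f⟩` is total on both sides, for all
idempotents `e R* a L* f`. -/
theorem connecting (hS : IdempotentConnected S) {a e f : S} (he : IsIdempotentElem e)
    (hf : IsIdempotentElem f) (hae : RStar a e) (haf : LStar a f) :
    (∀ x ∈ omegaSpan e, ∃ y ∈ omegaSpan f, x * a = a * y) ∧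
    ∀ y ∈ omegaSpan f, ∃ x ∈ omegaSpan e, x * a = a * y := by
  obtain ⟨e', f', he', hae', hf', haf', α, hα⟩ := hS a
  have e1 : e * e' = e' := hae'.idem_mul he' (hae.eq_mul he)
  have e2 : e' * e = e := hae.idem_mul he (hae'.eq_mul he')
  have f1 : f * f' = f := haf.mul_idem hf (haf'.mul_eq hf')
  have f2 : f' * f = f' := haf'.mul_idem hf' (haf.mul_eq hf)
  constructor
  · intro x hx
    let y := α ⟨x * e', omegaSpan_mul_greenR e1 e2 hx⟩
    refine ⟨f * y, omegaSpan_mul_greenL f1 f2 y.2, ?_⟩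
    rw [← mul_assoc, haf.mul_eq hf, ← hα, mul_assoc, hae'.eq_mul he']
  · intro y hy
    let x := α.symm ⟨f' * y, omegaSpan_mul_greenL f2 f1 hy⟩
    refine ⟨x * e, omegaSpan_mul_greenR e2 e1 x.2, ?_⟩
    rw [mul_assoc, hae.eq_mul he, hα, Equiv.apply_symm_apply, ← mul_assoc, haf'.mul_eq hf']

/-- Cancellation by a, through R* on one side and L* on the other, makes the relation x a = a y
single-valued both ways, so totality on both sides already gives a bijection. This symmetric form
passes easily to opposites and along isomorphisms. -/
theorem idempotentConnected_of_total
    (h : ∀ a : S, ∃ e f : S, IsIdempotentElem e ∧ RStar a e ∧ IsIdempotentElem f ∧ LStar a f ∧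
      (∀ x ∈ omegaSpan e, ∃ y ∈ omegaSpan f, x * a = a * y) ∧
      ∀ y ∈ omegaSpan f, ∃ x ∈ omegaSpan e, x * a = a * y) : IdempotentConnected S := by
  intro a
  obtain ⟨e, f, he, hae, hf, haf, h1, h2⟩ := h a
  refine ⟨e, f, he, hae, hf, haf, ?_⟩
  choose α hα hα' using h1
  refine ⟨Equiv.ofBijective (fun x : omegaSpan e => (⟨α x x.2, hα x x.2⟩ : omegaSpan f))
    ⟨fun x y hxy => ?_, fun y => ?_⟩, fun x => hα' x x.2⟩
  · have h3 : α x x.2 = α y y.2 := congrArg Subtype.val hxy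
    have h4 := hae.cancel (x := (x : S)) (y := y) (by rw [hα' x x.2, hα' y y.2, h3])
    rw [omegaSpan_mul_right x.2, omegaSpan_mul_right y.2] at h4
    exact Subtype.ext h4
  · obtain ⟨x, hx, hxy⟩ := h2 y y.2
    refine ⟨⟨x, hx⟩, Subtype.ext ?_⟩
    have h4 := haf.cancel (x := α x hx) (y := (y : S)) (by rw [← hα' x hx, hxy])
    rwa [omegaSpan_mul_left (hα x hx), omegaSpan_mul_left y.2] at h4

theorem map_mem_omegaSpan {T : Type u} [Semigroup T] (φ : S →ₙ* T) {e x : S}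
    (hx : x ∈ omegaSpan e) : φ x ∈ omegaSpan (φ e) := by
  induction hx using Subsemigroup.closure_induction with
  | mem g hg =>
    exact mem_omegaSpan (hg.1.map φ) (by rw [← map_mul, hg.2.1]) (by rw [← map_mul, hg.2.2])
  | mul x y _ _ ihx ihy => rw [map_mul]; exact mul_mem ihx ihy

theorem op_mem_omegaSpan {e x : S} (hx : x ∈ omegaSpan e) : op x ∈ omegaSpan (op e) := by
  induction hx using Subsemigroup.closure_induction with
  | mem g hg =>
    exact mem_omegaSpan (congrArg op hg.1) (congrArg op hg.2.2) (congrArg op hg.2.1)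
  | mul x y _ _ ihx ihy => rw [op_mul]; exact mul_mem ihy ihx

theorem unop_mem_omegaSpan {e x : Sᵐᵒᵖ} (hx : x ∈ omegaSpan e) : unop x ∈ omegaSpan (unop e) := by
  induction hx using Subsemigroup.closure_induction with
  | mem g hg =>
    exact mem_omegaSpan (congrArg unop hg.1) (congrArg unop hg.2.2) (congrArg unop hg.2.1)
  | mul x y _ _ ihx ihy => rw [unop_mul]; exact mul_mem ihy ihx

theorem map_mem_idemSpan {T : Type u} [Semigroup T] (φ : S →ₙ* T) {x : S}
    (hx : x ∈ Subsemigroup.closure {e : S | IsIdempotentElem e}) :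
    φ x ∈ Subsemigroup.closure {e : T | IsIdempotentElem e} := by
  induction hx using Subsemigroup.closure_induction with
  | mem g hg => exact Subsemigroup.subset_closure (IsIdempotentElem.map hg φ)
  | mul x y _ _ ihx ihy => rw [map_mul]; exact mul_mem ihx ihy

theorem op_mem_idemSpan {x : S} (hx : x ∈ Subsemigroup.closure {e : S | IsIdempotentElem e}) :
    op x ∈ Subsemigroup.closure {e : Sᵐᵒᵖ | IsIdempotentElem e} := by
  induction hx using Subsemigroup.closure_induction with
  | mem g hg => exact Subsemigroup.subset_closure (congrArg op hg)
  | mul x y _ _ ihx ihy => rw [op_mul]; exact mul_mem ihy ihx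

theorem unop_mem_idemSpan {x : Sᵐᵒᵖ}
    (hx : x ∈ Subsemigroup.closure {e : Sᵐᵒᵖ | IsIdempotentElem e}) :
    unop x ∈ Subsemigroup.closure {e : S | IsIdempotentElem e} := by
  induction hx using Subsemigroup.closure_induction with
  | mem g hg => exact Subsemigroup.subset_closure (congrArg unop hg)
  | mul x y _ _ ihx ihy => rw [unop_mul]; exact mul_mem ihy ihx

/-- Lets all that is proved about `𝕃` be applied to `ℝ(S)`. -/
instance (S : Type u) [Semigroup S] [Concordant S] : Concordant Sᵐᵒᵖ where
  idempotentConnected := idempotentConnected_of_total fun a => by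
    obtain ⟨e, he, hae⟩ := Abundant.exists_rstar (unop a)
    obtain ⟨f, hf, haf⟩ := Abundant.exists_lstar (unop a)
    obtain ⟨h1, h2⟩ := connecting Concordant.idempotentConnected he hf hae haf
    refine ⟨op f, op e, congrArg op hf, rstar_op_of_lstar haf, congrArg op he,
      lstar_op_of_rstar hae, fun x hx => ?_, fun y hy => ?_⟩
    · obtain ⟨y, hy, h⟩ := h2 _ (unop_mem_omegaSpan hx)
      exact ⟨op y, op_mem_omegaSpan hy, congrArg op h.symm⟩
    · obtain ⟨x, hx, h⟩ := h1 _ (unop_mem_omegaSpan hy)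
      exact ⟨op x, op_mem_omegaSpan hx, congrArg op h.symm⟩
  regular x hx := by
    obtain ⟨y, hy, h⟩ := Concordant.regular _ (unop_mem_idemSpan hx)
    exact ⟨op y, op_mem_idemSpan hy, congrArg op ((mul_assoc _ _ _).symm.trans h)⟩

theorem Concordant.of_mulEquiv {T : Type u} [Semigroup T] [Concordant S] (φ : S ≃* T) :
    Concordant T where
  exists_lstar a := by
    obtain ⟨e, he, h⟩ := Abundant.exists_lstar (φ.symm a)
    exact ⟨φ e, he.map φ, by simpa using h.map_equiv φ⟩
  exists_rstar a := by
    obtain ⟨e, he, h⟩ := Abundant.exists_rstar (φ.symm a)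
    exact ⟨φ e, he.map φ, by simpa using h.map_equiv φ⟩
  idempotentConnected := idempotentConnected_of_total fun a => by
    obtain ⟨e, he, hae⟩ := Abundant.exists_rstar (φ.symm a)
    obtain ⟨f, hf, haf⟩ := Abundant.exists_lstar (φ.symm a)
    obtain ⟨h1, h2⟩ := connecting Concordant.idempotentConnected he hf hae haf
    refine ⟨φ e, φ f, he.map φ, by simpa using hae.map_equiv φ, hf.map φ,
      by simpa using haf.map_equiv φ, fun x hx => ?_, fun y hy => ?_⟩
    · have hx' := map_mem_omegaSpan φ.symm.toMulHom hx
      obtain ⟨y, hy, h⟩ := h1 (φ.symm x) (by simpa using hx')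
      exact ⟨φ y, map_mem_omegaSpan φ.toMulHom hy, by simpa using congrArg φ h⟩
    · have hy' := map_mem_omegaSpan φ.symm.toMulHom hy
      obtain ⟨x, hx, h⟩ := h2 (φ.symm y) (by simpa using hy')
      exact ⟨φ x, map_mem_omegaSpan φ.toMulHom hx, by simpa using congrArg φ h⟩
  regular x hx := by
    obtain ⟨y, hy, h⟩ := Concordant.regular _ (map_mem_idemSpan φ.symm.toMulHom hx)
    exact ⟨φ y, map_mem_idemSpan φ.toMulHom hy, by simpa using congrArg φ h⟩

end OmegaSpan

/-! ### Morphisms and bimorphisms of `𝕃(S)`. -/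

section LObjBasics

variable {S : Type u} [Semigroup S]

@[ext]
theorem LObj.ext {A B : LObj S} (h : A.carrier = B.carrier) : A = B := by
  cases A; cases B; cases h; rfl

theorem LObj.mem_of_carrier {A : LObj S} {e x : S} (he : IsIdempotentElem e)
    (hA : A.carrier = leftIdeal e) : x ∈ A.carrier ↔ x * e = x := by
  rw [hA, mem_leftIdeal he]

theorem leftIdeal_eq_iff {e f : S} (he : IsIdempotentElem e) (hf : IsIdempotentElem f) :
    leftIdeal e = leftIdeal f ↔ e * f = e ∧ f * e = f := by
  constructor
  · intro h
    rw [← mem_leftIdeal hf, ← mem_leftIdeal he, h]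
    exact ⟨h ▸ (mem_leftIdeal he).2 he, (mem_leftIdeal hf).2 hf⟩
  · rintro ⟨h1, h2⟩
    ext x
    rw [mem_leftIdeal he, mem_leftIdeal hf]
    constructor
    · intro h; rw [← h, mul_assoc, h1]
    · intro h; rw [← h, mul_assoc, h2]

theorem LObj.subset_of_sub {A B : LObj S} (h : Sub A B) : A.carrier ⊆ B.carrier := by
  obtain ⟨j, hj⟩ := h
  intro x hx
  have := (LObj.apply j ⟨x, hx⟩).2
  rwa [hj ⟨x, hx⟩] at this

/-- The inclusion between objects of `𝕃(S)`. -/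
noncomputable def LObj.incl {A B : LObj S} (h : A.carrier ⊆ B.carrier) : A ⟶ B :=
  rho A.gen fun x hx => by rw [A.mem_iff.1 hx]; exact h hx

theorem LObj.apply_incl {A B : LObj S} (h : A.carrier ⊆ B.carrier) (x : A.carrier) :
    (LObj.apply (LObj.incl h) x : S) = x := A.mem_iff.1 x.2

theorem LObj.isIncl_incl {A B : LObj S} (h : A.carrier ⊆ B.carrier) : IsIncl (LObj.incl h) :=
  LObj.apply_incl h

theorem LObj.sub_iff {A B : LObj S} : Sub A B ↔ A.carrier ⊆ B.carrier :=
  ⟨LObj.subset_of_sub, fun h => ⟨_, LObj.isIncl_incl h⟩⟩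

theorem LObj.apply_mul {A B : LObj S} (φ : A ⟶ B) (s : S) (x : A.carrier) :
    (LObj.apply φ ⟨s * x, A.mul_mem s x.2⟩ : S) = s * LObj.apply φ x := by
  rw [LObj.apply_eq, LObj.apply_eq, mul_assoc]

/-- Frees computations from the chosen generator of A: the image of any right identity k ∈ A can
serve as the multiplier. -/
theorem LObj.apply_eq_mul {A B : LObj S} (φ : A ⟶ B) {k : S} (hk : k ∈ A.carrier)
    (x : A.carrier) (hx : (x : S) * k = x) :
    (LObj.apply φ x : S) = x * LObj.apply φ ⟨k, hk⟩ := by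
  rw [← LObj.apply_mul]
  congr 2
  exact Subtype.ext hx.symm

theorem mul_apply_gen {A B : LObj S} (φ : A ⟶ B) {k : S} (hk : k ∈ A.carrier)
    (hk' : IsIdempotentElem k) : k * (LObj.apply φ ⟨k, hk⟩ : S) = LObj.apply φ ⟨k, hk⟩ :=
  (LObj.apply_eq_mul φ hk ⟨k, hk⟩ hk').symm

/-- Bimorphisms of `𝕃(S)` are the `ρ(k,u,f)` with `k R* u L* f`. -/
theorem isBimorphism_iff [Abundant S] {A B : LObj S} (φ : A ⟶ B) {k f : S}
    (hk : IsIdempotentElem k) (hf : IsIdempotentElem f) (hA : A.carrier = leftIdeal k)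
    (hB : B.carrier = leftIdeal f) (hkA : k ∈ A.carrier) :
    IsBimorphism φ ↔
      RStar (LObj.apply φ ⟨k, hkA⟩ : S) k ∧ LStar (LObj.apply φ ⟨k, hkA⟩ : S) f := by
  have hφ : ∀ x : A.carrier, (LObj.apply φ x : S) = x * LObj.apply φ ⟨k, hkA⟩ := fun x =>
    LObj.apply_eq_mul φ hkA x ((LObj.mem_of_carrier hk hA).1 x.2)
  have hka := mul_apply_gen φ hkA hk
  have haf := (LObj.mem_of_carrier hf hB).1 (LObj.apply φ ⟨k, hkA⟩).2
  have haB := (LObj.apply φ ⟨k, hkA⟩).2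
  generalize (LObj.apply φ ⟨k, hkA⟩ : S) = a at hφ hka haf haB
  constructor
  · rintro ⟨h1, h2⟩
    constructor
    · obtain ⟨g, hg, hga⟩ := Abundant.exists_rstar a
      have hkg : k * g = g := hga.idem_mul hg hka
      refine hga.of_greenR hg ?_ hkg
      -- Since g k a = a, multiplication by g k followed by φ equals φ. Cancelling the monomorphism
      -- φ and evaluating at k gives g k = k.
      have h3 : (rho (g * k) fun x _ => by
          rw [← mul_assoc]; exact A.mul_mem _ hkA : A ⟶ A) = 𝟙 A := by
        rw [← cancel_mono φ]
        refine LObj.hom_ext fun x => ?_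
        rw [LObj.apply_comp, LObj.apply_comp, hφ, hφ, LObj.apply_rho, LObj.apply_id, mul_assoc,
          mul_assoc, hka, hga.eq_mul hg]
      have h4 := congrArg (fun ψ => (LObj.apply ψ ⟨k, hkA⟩ : S)) h3
      simp only [LObj.apply_rho, LObj.apply_id] at h4
      rwa [← mul_assoc, hkg] at h4
    · obtain ⟨l, hl, hla⟩ := Abundant.exists_lstar a
      have hlf : l * f = l := hla.mul_idem hl haf
      refine hla.of_greenL hl ?_ hlf
      have hfB : f ∈ B.carrier := (LObj.mem_of_carrier hf hB).2 hf
      -- Since a l = a, multiplication by l is absorbed by φ. Cancelling the epimorphism φ and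
      -- evaluating at f gives f l = f.
      have h3 : (rho l fun x _ => by
          rw [← hlf, ← mul_assoc]; exact B.mul_mem _ hfB : B ⟶ B) = 𝟙 B := by
        rw [← cancel_epi φ]
        refine LObj.hom_ext fun x => ?_
        rw [LObj.apply_comp, LObj.apply_comp, LObj.apply_rho, LObj.apply_id, hφ, mul_assoc,
          hla.mul_eq hl]
      exact congrArg (fun ψ => (LObj.apply ψ ⟨f, hfB⟩ : S)) h3
  · rintro ⟨h1, h2⟩
    have h3 : φ = rho a fun x hx => B.mul_mem x haB := LObj.hom_ext hφ
    rw [h3]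
    exact isBimorphism_rho hk hA hB h1 h2 hf _

end LObjBasics

/-! ### Strict inverses of functors and a criterion for consistency of a morphism. -/

section Abstract

/-- Consistency asks for an isomorphism of categories, with equalities of functors. Bijectivity on
objects upgrades a fully faithful functor to one, the inverse on morphisms being the preimage
conjugated by `eqToHom`. -/
theorem exists_strict_inverse {P : Type u} [Category.{v} P] {Q : Type u'} [Category.{v'} Q]
    (T : P ⥤ Q) [T.Full] [T.Faithful] (hT : Function.Bijective T.obj) :
    ∃ T' : Q ⥤ P, T ⋙ T' = 𝟭 _ ∧ T' ⋙ T = 𝟭 _ := by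
  let E := Equiv.ofBijective _ hT
  have hE : ∀ x, T.obj (E.symm x) = x := E.apply_symm_apply
  have hE' : ∀ x, E.symm (T.obj x) = x := E.symm_apply_apply
  let T' : Q ⥤ P :=
    { obj := E.symm
      map := fun {x y} f => T.preimage (eqToHom (hE x) ≫ f ≫ eqToHom (hE y).symm)
      map_id := fun x => T.map_injective (by simp)
      map_comp := fun f g => T.map_injective (by simp) }
  refine ⟨T', CategoryTheory.Functor.ext hE' fun x y f => T.map_injective ?_,
    CategoryTheory.Functor.ext hE fun x y f => ?_⟩
  · simp [T', eqToHom_map]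
  · simp [T']

variable {C : Type u} [Category.{v} C] [HasInclusions C]

theorem CoreIdeal.ext {c : C} {a b : CoreIdeal c} (h : a.obj = b.obj) : a = b := by
  cases a; cases b; cases h; rfl

theorem InCore.sub {c a b : C} {f : a ⟶ b} (h : InCore c f) : Sub a c ∧ Sub b c := by
  induction h with
  | incl _ h1 h2 _ => exact ⟨h1, h2⟩
  | retraction _ h1 h2 _ => exact ⟨h1, h2⟩
  | comp _ _ _ _ h1 h2 => exact ⟨h1.1, h2.2⟩

variable [FactorizationCategory C]

theorem isEpiPart_of_fac {a b m : C} {f : a ⟶ b} (e : a ⟶ m) [Epi e] (j : m ⟶ b) (hj : IsIncl j)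
    (h : e ≫ j = f) : IsEpiPart f e := by
  obtain ⟨k, hk, -⟩ := epiPart_unique (isIncl_imIncl f) hj ((epiPart_imIncl f).trans h.symm)
  exact ⟨k, hk⟩

theorem IsEpiPart.fac {a b m : C} {f : a ⟶ b} {e : a ⟶ m} (h : IsEpiPart f e) :
    Epi e ∧ ∃ j : m ⟶ b, IsIncl j ∧ e ≫ j = f := by
  obtain ⟨k, hk⟩ := h
  subst k
  subst hk
  rw [eqToHom_refl, Category.comp_id]
  exact ⟨inferInstance, imIncl f, isIncl_imIncl f, epiPart_imIncl f⟩

/-- A bimorphism is consistent as soon as the epimorphic components of its restrictions are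
monomorphisms that match the morphisms of `⟨c⟩` with those of `⟨d⟩`. -/
theorem isConsistentMorphism_of_matching {c d : C} (u : c ⟶ d) (O : CoreIdeal c → CoreIdeal d)
    (hO : Function.Bijective O) (τ : ∀ a : CoreIdeal c, a.obj ⟶ (O a).obj)
    (hmono : ∀ a, Mono (τ a)) (hτ : ∀ (a : CoreIdeal c) (j : a.obj ⟶ c), IsIncl j →
      IsEpiPart (j ≫ u) (τ a))
    (h1 : ∀ {a b : CoreIdeal c} (m : a ⟶ b), ∃ n : O a ⟶ O b, m.1 ≫ τ b = τ a ≫ n.1)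
    (h2 : ∀ {a b : CoreIdeal c} (n : O a ⟶ O b), ∃ m : a ⟶ b, m.1 ≫ τ b = τ a ≫ n.1) :
    IsConsistentMorphism u := by
  have hepi : ∀ a, Epi (τ a) := fun a => by
    obtain ⟨j, hj⟩ := a.sub
    exact (hτ a j hj).fac.1
  -- Each `τ a` is an epimorphism, so the partner `M m` is unique; this yields functoriality for
  -- free.
  choose M hM using @h1
  let T : CoreIdeal c ⥤ CoreIdeal d :=
    { obj := O
      map := M
      map_id := fun a => Subtype.ext (by
        rw [← cancel_epi (τ a), ← hM]
        exact (Category.id_comp _).trans (Category.comp_id _).symm)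
      map_comp := fun {a b e} f g => Subtype.ext (by
        rw [← cancel_epi (τ a), ← hM]
        change (f.1 ≫ g.1) ≫ τ e = τ a ≫ (M f).1 ≫ (M g).1
        rw [Category.assoc, hM, ← Category.assoc, hM, Category.assoc]) }
  have hfull : T.Full := ⟨fun {a b} n => by
    obtain ⟨m, hm⟩ := h2 n
    refine ⟨m, Subtype.ext ?_⟩
    rw [← cancel_epi (τ a), ← hm]
    exact (hM m).symm⟩
  have hfaith : T.Faithful := ⟨fun {a b m m'} h => Subtype.ext (by
    rw [← cancel_mono (τ b), hM, hM]
    exact congrArg (fun n : O a ⟶ O b => τ a ≫ n.1) h)⟩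
  refine ⟨T, ⟨exists_strict_inverse T hO, ⟨fun {a b} m hm => ?_, τ, hτ, hM⟩⟩, ?_⟩
  -- Followed by the inclusion of the target in d, the image of an inclusion is the inclusion of its
  -- source in d, as cancelling `τ a` shows; hence it is itself an inclusion.
  · obtain ⟨j, hj⟩ := b.sub
    obtain ⟨-, k, hk, hk'⟩ := (hτ b j hj).fac
    obtain ⟨-, l, hl, hl'⟩ := (hτ a _ (CategoryWithSubobjects.incl_comp _ _ hm hj)).fac
    refine CategoryWithSubobjects.incl_of_comp _ k hk ?_
    have : (M m).1 ≫ k = l := by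
      rw [← cancel_epi (τ a), ← Category.assoc, ← hM, Category.assoc, hk', hl', Category.assoc]
    exact this ▸ hl
  -- Uniqueness: the image of j u fixes the objects, its epimorphic component fixes τ, and
  -- cancelling τ fixes the morphisms.
  · rintro ⟨O', M', hid, hcomp⟩ ⟨-, -, τ', hτ', hM'⟩
    change ∀ {a b : CoreIdeal c} (m : a ⟶ b), m.1 ≫ τ' b = τ' a ≫ (M' m).1 at hM'
    have hOO : O' = O := funext fun a => CoreIdeal.ext (by
      obtain ⟨j, hj⟩ := a.sub
      obtain ⟨k, -⟩ := hτ a j hj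
      obtain ⟨k', -⟩ := hτ' a j hj
      exact k'.symm.trans k)
    subst hOO
    have hττ : τ' = τ := funext fun a => by
      obtain ⟨j, hj⟩ := a.sub
      obtain ⟨k, hk⟩ := hτ a j hj
      obtain ⟨k', hk'⟩ := hτ' a j hj
      exact hk'.symm.trans hk
    subst hττ
    have hMM : @M' = @M := by
      funext a b m
      refine Subtype.ext ?_
      rw [← cancel_epi (τ' a), ← hM]
      exact (hM' m).symm
    subst hMM
    rfl

end Abstract

/-! ### Consistency of bimorphisms and normal factorizations in `𝕃(S)`. -/

section LObjConsistent

variable {S : Type u} [Semigroup S]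

/-- Multiplying a generator of X on the left by e, where A = Se, stays in the same L-class and
brings the generator below e. -/
theorem LObj.exists_gen_of_sub {X A : LObj S} (h : Sub X A) : ∃ g : S, IsIdempotentElem g ∧
    X.carrier = leftIdeal g ∧ g * A.gen = g ∧ A.gen * g = g := by
  have h1 : X.gen * A.gen = X.gen := A.mem_iff.1 (LObj.subset_of_sub h X.gen_mem)
  have h2 : IsIdempotentElem (A.gen * X.gen) := by
    change A.gen * X.gen * (A.gen * X.gen) = A.gen * X.gen
    rw [mul_assoc, ← mul_assoc X.gen, h1, X.gen_idem.eq]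
  refine ⟨A.gen * X.gen, h2, ?_, ?_, ?_⟩
  · rw [X.carrier_eq, leftIdeal_eq_iff X.gen_idem h2]
    exact ⟨by rw [← mul_assoc, h1, X.gen_idem.eq], by rw [mul_assoc, X.gen_idem.eq]⟩
  · rw [mul_assoc, h1]
  · rw [← mul_assoc, A.gen_idem.eq]

/-- The morphisms of `⟨S e⟩` are the right multiplications by the elements of `⟨e⟩`. -/
theorem inCore_iff {A X Y : LObj S} (hX : Sub X A) (hY : Sub Y A) (φ : X ⟶ Y) :
    InCore A φ ↔ ∃ w ∈ omegaSpan A.gen, ∀ x : X.carrier, (LObj.apply φ x : S) = x * w := by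
  constructor
  · intro h
    induction h with
    | incl j h1 h2 h3 =>
      exact ⟨A.gen, mem_omegaSpan A.gen_idem A.gen_idem A.gen_idem, fun x =>
        (h3 x).trans (A.mem_iff.1 (LObj.subset_of_sub h1 x.2)).symm⟩
    | @retraction X Y q h1 h2 h3 =>
      obtain ⟨j, hj, hjq⟩ := h3
      obtain ⟨g, hg, hXg, g1, g2⟩ := LObj.exists_gen_of_sub h1
      obtain ⟨k, hk, hYk, k1, k2⟩ := LObj.exists_gen_of_sub h2
      have hgX : g ∈ X.carrier := (LObj.mem_of_carrier hg hXg).2 hg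
      obtain ⟨w, hw⟩ : ∃ w : S, w = (LObj.apply q ⟨g, hgX⟩ : Y.carrier) := ⟨_, rfl⟩
      have hq : ∀ x : X.carrier, (LObj.apply q x : S) = x * w := fun x => by
        rw [hw, LObj.apply_eq_mul q hgX x ((LObj.mem_of_carrier hg hXg).1 x.2)]
      have hY' : ∀ y : Y.carrier, (y : S) * w = y := fun y => by
        have := congrArg (fun ψ => (LObj.apply ψ y : S)) hjq
        simp only [LObj.apply_comp, LObj.apply_id] at this
        rwa [hq, hj] at this
      have hgw : g * w = w := by rw [hw, mul_apply_gen q hgX hg]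
      have hwY : w ∈ Y.carrier := by rw [hw]; exact Subtype.prop _
      -- The retraction fixes every element of Y, and its multiplier w itself lies in Y.
      have hww : w * w = w := hY' ⟨w, hwY⟩
      refine ⟨w, mem_omegaSpan hww ?_ ?_, hq⟩
      · exact A.mem_iff.1 (LObj.subset_of_sub h2 hwY)
      · rw [← hgw, ← mul_assoc, g2]
    | comp f g hf hg ihf ihg =>
      obtain ⟨w, hw, h1⟩ := ihf hf.sub.1 hf.sub.2
      obtain ⟨w', hw', h2⟩ := ihg hg.sub.1 hg.sub.2
      exact ⟨w * w', mul_mem hw hw', fun x => by rw [LObj.apply_comp, h2, h1, mul_assoc]⟩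
  · rintro ⟨w, hw, hφ⟩
    have hAA : Sub A A := ⟨𝟙 A, CategoryWithSubobjects.incl_id A⟩
    -- Endomorphisms of A are treated first: for X → Y the partial products of a word in idempotents
    -- need not land in Y, but they always land in A.
    have key : ∀ w (hw : w ∈ omegaSpan A.gen), ∀ ψ : A ⟶ A,
        (∀ x : A.carrier, (LObj.apply ψ x : S) = x * w) → InCore A ψ := by
      intro w hw
      induction hw using Subsemigroup.closure_induction with
      | mem g hg =>
        intro ψ hψ
        have hGA : Sub (LObj.of g hg.1) A := LObj.sub_iff.2 fun x hx => by
          rw [A.mem_iff, ← LObj.mem_of.1 hx, mul_assoc, hg.2.1]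
        have h1 : ψ = (rho g fun x _ => LObj.mem_of.2 (by rw [mul_assoc, hg.1.eq]) :
            A ⟶ LObj.of g hg.1) ≫ LObj.incl (LObj.subset_of_sub hGA) :=
          LObj.hom_ext fun x => by rw [LObj.apply_comp, LObj.apply_incl, LObj.apply_rho, hψ]
        rw [h1]
        refine .comp _ _ (.retraction _ hAA hGA ⟨LObj.incl (LObj.subset_of_sub hGA),
          LObj.isIncl_incl _, LObj.hom_ext fun x => ?_⟩) (.incl _ hGA hAA (LObj.isIncl_incl _))
        rw [LObj.apply_comp, LObj.apply_rho, LObj.apply_incl, LObj.apply_id, LObj.mem_of.1 x.2]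
      | mul x y hx hy ihx ihy =>
        intro ψ hψ
        have hm : ∀ z ∈ omegaSpan A.gen, ∀ s ∈ A.carrier, s * z ∈ A.carrier := fun z hz s _ => by
          rw [A.mem_iff, mul_assoc, omegaSpan_mul_right hz]
        have h1 : ψ = (rho x (hm x hx) : A ⟶ A) ≫ (rho y (hm y hy) : A ⟶ A) :=
          LObj.hom_ext fun z => by
            rw [LObj.apply_comp, LObj.apply_rho, LObj.apply_rho, hψ, mul_assoc]
        rw [h1]
        exact .comp _ _ (ihx _ fun _ => rfl) (ihy _ fun _ => rfl)
    obtain ⟨g, hg, hYg, g1, g2⟩ := LObj.exists_gen_of_sub hY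
    have hmA : ∀ x ∈ A.carrier, x * w ∈ A.carrier := fun x _ => by
      rw [A.mem_iff, mul_assoc, omegaSpan_mul_right hw]
    have hmY : ∀ x ∈ A.carrier, x * g ∈ Y.carrier := fun x _ => by
      rw [LObj.mem_of_carrier hg hYg, mul_assoc, hg.eq]
    -- Include X in A, multiply by w there, and retract onto Y; the last factor changes nothing,
    -- because the products x w already lie in Y.
    have h1 : φ = LObj.incl (LObj.subset_of_sub hX) ≫ (rho w hmA : A ⟶ A) ≫ rho g hmY :=
      LObj.hom_ext fun x => by
        rw [LObj.apply_comp, LObj.apply_comp, LObj.apply_rho, LObj.apply_rho, LObj.apply_incl,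
          ← hφ, (LObj.mem_of_carrier hg hYg).1 (LObj.apply φ x).2]
    rw [h1]
    refine .comp _ _ (.incl _ hX hAA (LObj.isIncl_incl _)) (.comp _ _ (key w hw _ fun _ => rfl)
      (.retraction _ hAA hY ⟨LObj.incl (LObj.subset_of_sub hY), LObj.isIncl_incl _,
        LObj.hom_ext fun x => ?_⟩))
    rw [LObj.apply_comp, LObj.apply_rho, LObj.apply_incl, LObj.apply_id,
      (LObj.mem_of_carrier hg hYg).1 x.2]

/-- Let φ be multiplication by a. A subobject SG with G below e is sent to Sy, where G a = a y. The
restriction of φ is again multiplication by a, and it is a bimorphism SG → Sy because G a is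
R*-related to G and L*-related to y. Multiplication by w ∈ ⟨e⟩ is matched with multiplication by w'
∈ ⟨f⟩ through w a = a w'. -/
theorem isConsistentMorphism_of_isBimorphism [Concordant S] {A B : LObj S} (φ : A ⟶ B)
    (hφ : IsBimorphism φ) : IsConsistentMorphism φ := by
  obtain ⟨hae, haf⟩ := (isBimorphism_iff φ A.gen_idem B.gen_idem A.carrier_eq B.carrier_eq
    A.gen_mem).1 hφ
  have hφa := LObj.apply_eq φ
  change RStar (LObj.coef φ) _ at hae
  change LStar (LObj.coef φ) _ at haf
  set a := LObj.coef φ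
  set e := A.gen with he
  set f := B.gen with hf
  have hei : IsIdempotentElem e := A.gen_idem
  have hfi : IsIdempotentElem f := B.gen_idem
  obtain ⟨c1, c2⟩ := connecting Concordant.idempotentConnected hei hfi hae haf
  -- Right multiplication by a is injective on Se, and left multiplication by a is injective on fS.
  -- Every identity below is checked after one of these.
  have canR : ∀ {x y : S}, x * e = x → y * e = y → x * a = y * a → x = y := fun hx hy h => by
    have := hae.cancel h
    rwa [hx, hy] at this
  have canL : ∀ {x y : S}, f * x = x → f * y = y → a * x = a * y → x = y := fun hx hy h => by
    have := haf.cancel h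
    rwa [hx, hy] at this
  choose G hGi hGc hGe heG using fun X : CoreIdeal A => LObj.exists_gen_of_sub X.sub
  have hGΩ : ∀ X, G X ∈ omegaSpan e := fun X => mem_omegaSpan (hGi X) (hGe X) (heG X)
  choose y hyΩ hy using fun X : CoreIdeal A => c1 (G X) (hGΩ X)
  have hfy : ∀ X, f * y X = y X := fun X => omegaSpan_mul_left (hyΩ X)
  have hyf : ∀ X, y X * f = y X := fun X => omegaSpan_mul_right (hyΩ X)
  have hyi : ∀ X, IsIdempotentElem (y X) := fun X => by
    refine canL (by rw [← mul_assoc, hfy]) (hfy X) ?_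
    rw [← mul_assoc, ← hy, mul_assoc, ← hy, ← mul_assoc, (hGi X).eq]
  let O : CoreIdeal A → CoreIdeal B := fun X => ⟨LObj.of (y X) (hyi X), LObj.sub_iff.2 fun x hx => by
    rw [B.mem_iff, ← LObj.mem_of.1 hx, mul_assoc, hyf]⟩
  have hXG : ∀ X (x : X.obj.carrier), (x : S) * G X = x := fun X x =>
    (LObj.mem_of_carrier (hGi X) (hGc X)).1 x.2
  have hGX : ∀ X, G X ∈ X.obj.carrier := fun X => (LObj.mem_of_carrier (hGi X) (hGc X)).2 (hGi X)
  let τ : ∀ X : CoreIdeal A, X.obj ⟶ (O X).obj := fun X => rho a fun x hx =>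
    (LObj.mem_of (he := hyi X)).2 (by
    rw [mul_assoc, ← hy, ← mul_assoc, hXG X ⟨x, hx⟩])
  have hτ : ∀ X, IsBimorphism (τ X) := fun X => by
    refine (isBimorphism_iff (τ X) (hGi X) (hyi X) (hGc X) rfl (hGX X)).2 ⟨?_, ?_⟩
    · refine .of_cancel (hGi X) (mul_apply_gen _ _ (hGi X)) fun s t h => ?_
      change s * (G X * a) = t * (G X * a) at h
      rw [← mul_assoc, ← mul_assoc] at h
      exact canR (by rw [mul_assoc, hGe]) (by rw [mul_assoc, hGe]) h
    · change LStar (G X * a) (y X)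
      rw [hy]
      refine .of_cancel (hyi X) (by rw [mul_assoc, (hyi X).eq]) fun s t h => ?_
      rw [mul_assoc, mul_assoc] at h
      exact canL (by rw [← mul_assoc, hfy]) (by rw [← mul_assoc, hfy]) h
  refine isConsistentMorphism_of_matching φ O ⟨fun X X' h => ?_, fun Y => ?_⟩ τ
    (fun X => (hτ X).1) (fun X j hj => ?_) (fun {X Y} m => ?_) (fun {X Y} n => ?_)
  · have h1 : leftIdeal (y X) = leftIdeal (y X') := congrArg (fun Y => Y.obj.carrier) h
    rw [leftIdeal_eq_iff (hyi X) (hyi X')] at h1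
    refine CoreIdeal.ext (LObj.ext ?_)
    rw [hGc, hGc, leftIdeal_eq_iff (hGi X) (hGi X')]
    constructor
    · refine canR (by rw [mul_assoc, hGe]) (hGe X) ?_
      rw [mul_assoc, hy, ← mul_assoc, hy, mul_assoc, h1.1]
    · refine canR (by rw [mul_assoc, hGe]) (hGe X') ?_
      rw [mul_assoc, hy, ← mul_assoc, hy, mul_assoc, h1.2]
  -- Pull k back to x with x a = a k. The generator `G X` chosen for X = Sx need not be x, but it is
  -- L-related to x, and this makes `y X` L-related to k.
  · obtain ⟨k, hk, hYk, k1, k2⟩ := LObj.exists_gen_of_sub Y.sub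
    obtain ⟨x, hx, hxk⟩ := c2 k (mem_omegaSpan hk k1 k2)
    have hxe : x * e = x := omegaSpan_mul_right hx
    have hxi : IsIdempotentElem x := by
      refine canR (by rw [mul_assoc, hxe]) hxe ?_
      rw [mul_assoc, hxk, ← mul_assoc, hxk, mul_assoc, hk.eq]
    let X : CoreIdeal A := ⟨LObj.of x hxi, LObj.sub_iff.2 fun s hs => by
      rw [A.mem_iff, ← LObj.mem_of.1 hs, mul_assoc, hxe]⟩
    have h1 : leftIdeal x = leftIdeal (G X) := hGc X
    rw [leftIdeal_eq_iff hxi (hGi X)] at h1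
    refine ⟨X, CoreIdeal.ext (LObj.ext ?_)⟩
    change leftIdeal (y X) = Y.obj.carrier
    rw [hYk, leftIdeal_eq_iff (hyi X) hk]
    constructor
    · refine canL (by rw [← mul_assoc, hfy]) (hfy X) ?_
      rw [← mul_assoc, ← hy, mul_assoc, ← hxk, ← mul_assoc, h1.2]
    · refine canL (by rw [← mul_assoc, k2]) k2 ?_
      rw [← mul_assoc, ← hxk, mul_assoc, ← hy, ← mul_assoc, h1.1]
  · have := (hτ X).2
    refine isEpiPart_of_fac (τ X) (LObj.incl (LObj.subset_of_sub (O X).sub)) (LObj.isIncl_incl _)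
      (LObj.hom_ext fun x => ?_)
    rw [LObj.apply_comp, LObj.apply_comp, LObj.apply_incl, hφa, hj]
    rfl
  · obtain ⟨w, hw, hmw⟩ := (inCore_iff X.sub Y.sub m.1).1 m.2
    obtain ⟨w', hw', hww⟩ := c1 w hw
    -- The factor `y Y` forces the values into the target. It does not affect the square, since the
    -- values of m are fixed by `G Y`, and `G Y * a = a * y Y`.
    refine ⟨⟨rho (w' * y Y) fun x _ => (LObj.mem_of (he := hyi Y)).2 (by
      rw [mul_assoc, mul_assoc, (hyi Y).eq]), (inCore_iff (O X).sub (O Y).sub _).2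
        ⟨_, mul_mem hw' (hyΩ Y), fun _ => rfl⟩⟩, LObj.hom_ext fun x => ?_⟩
    change (LObj.apply m.1 x : S) * a = x * a * (w' * y Y)
    rw [← hXG Y (LObj.apply m.1 x), mul_assoc, hy, hmw, mul_assoc, ← mul_assoc w, hww]
    simp only [mul_assoc]
  · obtain ⟨w, hw, hmw⟩ := (inCore_iff (O X).sub (O Y).sub n.1).1 n.2
    obtain ⟨w', hw', hww⟩ := c2 w hw
    refine ⟨⟨rho (w' * G Y) fun x _ => (LObj.mem_of_carrier (hGi Y) (hGc Y)).2 (by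
      rw [mul_assoc, mul_assoc, (hGi Y).eq]), (inCore_iff X.sub Y.sub _).2
        ⟨_, mul_mem hw' (hGΩ Y), fun _ => rfl⟩⟩, LObj.hom_ext fun x => ?_⟩
    change (x : S) * (w' * G Y) * a = LObj.apply n.1 (LObj.apply (τ X) x)
    rw [← (LObj.mem_of (he := hyi Y)).1 (LObj.apply n.1 (LObj.apply (τ X) x)).2, hmw]
    change _ = (x : S) * a * w * y Y
    rw [mul_assoc (x : S) a, ← hww]
    simp only [mul_assoc]
    rw [hy]

/-- On A = Sg the composite is multiplication by g k with k idempotent. An inverse y of g k in the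
regular sense gives idempotents p = g k y g and l = y g k, and the composite factors as A → Sp → Sl
⊆ C. The middle map is multiplication by k, and its inverse is multiplication by y g. -/
theorem hasNormalFactorization_incl_retraction [Concordant S] {A B C : LObj S} (j : A ⟶ B)
    (q : B ⟶ C) (hj : IsIncl j) (hq : IsRetraction q) : HasNormalFactorization (j ≫ q) := by
  obtain ⟨i, hi, hiq⟩ := hq
  set k : S := LObj.coef q with hk
  set g := A.gen with hg
  have hgi : g * g = g := A.gen_idem
  have hkC : ∀ x : C.carrier, (x : S) * k = x := fun x => by
    have := congrArg (fun ψ => (LObj.apply ψ x : S)) hiq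
    simp only [LObj.apply_comp, LObj.apply_id] at this
    rwa [LObj.apply_eq, hi] at this
  have hki : IsIdempotentElem k := hkC (LObj.apply q ⟨B.gen, B.gen_mem⟩)
  have hkmem : k ∈ C.carrier := LObj.coef_mem q
  obtain ⟨y, -, hy⟩ := Concordant.regular (g * k) (mul_mem
    (Subsemigroup.subset_closure A.gen_idem) (Subsemigroup.subset_closure hki))
  -- The idempotent g k y would generate the right ideal of g k just as well; the final g is what
  -- places Sp inside A.
  have hp : IsIdempotentElem (g * k * y * g) := by
    change g * k * y * g * (g * k * y * g) = g * k * y * g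
    calc g * k * y * g * (g * k * y * g) = g * k * y * (g * g) * k * y * g := by
          simp only [mul_assoc]
      _ = g * k * y * (g * k) * y * g := by rw [hgi]; simp only [mul_assoc]
      _ = _ := by rw [hy]
  have hl : IsIdempotentElem (y * (g * k)) := by
    change y * (g * k) * (y * (g * k)) = y * (g * k)
    rw [mul_assoc, ← mul_assoc (g * k), hy]
  have hpk : g * k * y * g * k = g * k := by rw [mul_assoc (g * k * y), hy]
  let P := LObj.of _ hp
  let L := LObj.of _ hl
  have hPA : P.carrier ⊆ A.carrier := fun x hx => by
    rw [A.mem_iff, ← LObj.mem_of.1 hx, mul_assoc, mul_assoc _ g, hgi]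
  have hLC : L.carrier ⊆ C.carrier := fun x hx => by
    rw [← LObj.mem_of.1 hx, ← mul_assoc, ← mul_assoc]
    exact C.mul_mem _ hkmem
  let uu : P ⟶ L := rho k fun x hx => LObj.mem_of.2 (by
    nth_rewrite 1 [← LObj.mem_of.1 hx]
    nth_rewrite 2 [← LObj.mem_of.1 hx]
    rw [mul_assoc x _ k, hpk, mul_assoc x, ← mul_assoc (g * k), hy])
  let vv : L ⟶ P := rho (y * g) fun x hx => LObj.mem_of.2 (by
    have h1 : x * (y * g) = x * y * (g * k * y * g) := by
      nth_rewrite 1 [← LObj.mem_of.1 hx]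
      simp only [mul_assoc]
    rw [h1, mul_assoc, hp.eq])
  have huv : uu ≫ vv = 𝟙 P := LObj.hom_ext fun x => by
    change (x : S) * k * (y * g) = x
    nth_rewrite 1 [← LObj.mem_of.1 x.2]
    rw [mul_assoc (x : S), hpk]
    nth_rewrite 2 [← LObj.mem_of.1 x.2]
    simp only [mul_assoc]
  have hvu : vv ≫ uu = 𝟙 L := LObj.hom_ext fun x => by
    change (x : S) * (y * g) * k = x
    nth_rewrite 2 [← LObj.mem_of.1 x.2]
    simp only [mul_assoc]
  refine ⟨P, L, rho (g * k * y * g) fun x _ => LObj.mem_of.2 (by rw [mul_assoc, hp.eq]), uu,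
    LObj.incl hLC, ⟨LObj.incl hPA, LObj.isIncl_incl _, LObj.hom_ext fun x => ?_⟩,
    ⟨vv, huv, hvu⟩, LObj.isIncl_incl _, LObj.hom_ext fun x => ?_⟩
  · rw [LObj.apply_comp, LObj.apply_rho, LObj.apply_incl, LObj.apply_id, LObj.mem_of.1 x.2]
  · rw [LObj.apply_comp, LObj.apply_comp, LObj.apply_comp, LObj.apply_incl, LObj.apply_eq q, hj]
    change (x : S) * (g * k * y * g) * k = x * k
    rw [mul_assoc, hpk, ← mul_assoc, A.mem_iff.1 x.2]

end LObjConsistent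

/-! ### Principal cones and their `H`-functors. -/

section PrincipalCones

variable {S : Type u} [Semigroup S] [Abundant S]

/-- The principal cone `ρᵃ` together with its vertex. -/
noncomputable def pcone (a : S) : Cones (LObj S) := ⟨coneVertex a, principalCone a⟩

theorem mem_coneVertex (a : S) : a ∈ (coneVertex a).carrier :=
  LObj.mem_of.2 ((lstar_lstarIdem a).mul_eq (lstarIdem_idem a))

theorem eq_mul_of_pcone_eq {a b : S} (h : pcone a = pcone b) {e : S} (he : IsIdempotentElem e) :
    e * a = e * b :=
  congrArg (fun γ : Cones (LObj S) =>
    ((LObj.apply (γ.2.app (LObj.of e he)) ⟨e, LObj.mem_of.2 he⟩ : γ.1.carrier) : S)) h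

/-- If a L* l, then g is multiplication by v = g(l), and w = g(a) = a v. For k L* w, multiplication
by v is an epimorphism Sl → Sk followed by Sk ⊆ D, and x a v = x w identifies the components. The
hypothesis is an equality of cones with vertex, so that cones with a vertex not literally
`coneVertex a` are covered. -/
theorem cones_star_eq {c : LObj S} {γ : ConeAt c} {a : S}
    (h : (⟨c, γ⟩ : Cones (LObj S)) = pcone a) {D : LObj S} (g : c ⟶ D) (ha : a ∈ c.carrier) :
    γ.star g = pcone (S := S) (LObj.apply g ⟨a, ha⟩ : D.carrier) := by
  cases h
  obtain ⟨w, hw⟩ : ∃ w : S, w = (LObj.apply g ⟨a, ha⟩ : D.carrier) := ⟨_, rfl⟩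
  rw [← hw]
  have hl := lstarIdem_idem a
  have hla := lstar_lstarIdem a
  set l := lstarIdem a
  have hlc : l ∈ (coneVertex a).carrier := LObj.mem_of.2 hl
  obtain ⟨v, hv⟩ : ∃ v : S, v = (LObj.apply g ⟨l, hlc⟩ : D.carrier) := ⟨_, rfl⟩
  have hvD : v ∈ D.carrier := by rw [hv]; exact Subtype.prop _
  have hg : ∀ x : (coneVertex a).carrier, (LObj.apply g x : S) = x * v := fun x => by
    rw [hv, LObj.apply_eq_mul g hlc x (LObj.mem_of.1 x.2)]
  have hwv : w = a * v := by rw [hw, hg]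
  have hlv : l * v = v := by rw [hv, mul_apply_gen g hlc hl]
  have hk := lstarIdem_idem w
  have hkw := lstar_lstarIdem w
  set k := lstarIdem w
  -- From a v k = w k = w = a v, cancelling a through a L* l.
  have hvk : v * k = v := by
    have := hla.cancel (x := v * k) (y := v) (by rw [← mul_assoc, ← hwv, hkw.mul_eq hk])
    rwa [← mul_assoc, hlv] at this
  let e : coneVertex a ⟶ coneVertex w := rho v fun x _ => LObj.mem_of.2 (by
    rw [mul_assoc]; exact congrArg _ hvk)
  -- Two morphisms equalized by e agree at w, the image of a; since w L* k they agree on all of Sk.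
  have he : Epi e := ⟨fun {E} φ ψ h => LObj.hom_ext fun x => by
    have h1 := congrArg (fun χ => (LObj.apply χ ⟨a, ha⟩ : S)) h
    simp only [LObj.apply_comp, LObj.apply_eq φ, LObj.apply_eq ψ] at h1
    change a * v * _ = a * v * _ at h1
    rw [← hwv] at h1
    have h2 := hkw.cancel h1
    have hx : (x : S) * k = x := LObj.mem_of.1 x.2
    rw [LObj.apply_eq φ, LObj.apply_eq ψ, ← hx, mul_assoc, mul_assoc, h2]⟩
  have hsub : (coneVertex w).carrier ⊆ D.carrier := fun x hx => by
    have hx' : x * k = x := LObj.mem_of.1 hx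
    have hkD : k * D.gen = k := hkw.mul_idem hk
      (D.mem_iff.1 (by rw [hw]; exact Subtype.prop _))
    rw [D.mem_iff, ← hx', mul_assoc, hkD]
  rw [ConeAt.star_eq _ g e (LObj.incl hsub) (LObj.isIncl_incl _) (LObj.hom_ext fun x => by
    rw [LObj.apply_comp, LObj.apply_incl, hg]; rfl)]
  refine congrArg (Sigma.mk (coneVertex w)) (ConeAt.ext (funext fun A => LObj.hom_ext fun x => ?_))
  change (x : S) * a * v = x * w
  rw [mul_assoc, ← hwv]

theorem pcone_mul (a b : S) : pcone a * pcone b = pcone (a * b) := by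
  rw [cones_mul_def]
  exact cones_star_eq rfl _ (mem_coneVertex a)

theorem exists_mem_LObj (a : S) : ∃ D : LObj S, a ∈ D.carrier := ⟨_, mem_coneVertex a⟩

theorem cone_star_id {C : Type u} [Category.{v} C] [HasInclusions C] [FactorizationCategory C]
    {c : C} (γ : ConeAt c) : γ.star (𝟙 c) = ⟨c, γ⟩ := by
  rw [ConeAt.star_eq γ (𝟙 c) (𝟙 c) (𝟙 c) (CategoryWithSubobjects.incl_id c) (by simp)]
  congr 1
  ext a; simp [ConeAt.postcomp]

/-- Together with `pcone_injOn`, this reads H(ρᵃ; D) as aS ∩ D, so that cones can be replaced by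
elements of S. -/
theorem mem_Hset_iff {a : S} (ha : IsIdempotentElem a) {D : LObj S} {γ : Cones (LObj S)} :
    γ ∈ Hset (principalCone a) D ↔ ∃ w ∈ D.carrier, a * w = w ∧ γ = pcone w := by
  constructor
  · rintro ⟨f, rfl⟩
    exact ⟨_, (LObj.apply f ⟨a, mem_coneVertex a⟩).2, mul_apply_gen f (mem_coneVertex a) ha,
      cones_star_eq rfl f (mem_coneVertex a)⟩
  · rintro ⟨w, hw, haw, rfl⟩
    refine ⟨rho w fun x _ => D.mul_mem x hw, ?_⟩
    rw [cones_star_eq rfl _ (mem_coneVertex a), LObj.apply_rho, haw]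

theorem pcone_injOn {a w w' : S} (ha : IsIdempotentElem a) (h : a * w = w) (h' : a * w' = w')
    (hw : pcone w = pcone w') : w = w' := by
  have := eq_mul_of_pcone_eq hw ha
  rwa [h, h'] at this

theorem apply_eta {a : S} (ha : IsIdempotentElem a) {D : LObj S}
    (γ : Hset (principalCone a) D) {w : S} (hw : a * w = w) (hγ : γ.1 = pcone w)
    (x : (coneVertex a).carrier) : (LObj.apply (eta γ) x : S) = x * w := by
  have h1 := star_eta γ
  rw [hγ, cones_star_eq rfl _ (mem_coneVertex a)] at h1
  have h2 := pcone_injOn ha (mul_apply_gen _ (mem_coneVertex a) ha) hw h1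
  rw [LObj.apply_eq_mul _ (mem_coneVertex a) x
    ((LObj.mem_of_carrier ha (coneVertex_carrier ha)).1 x.2), h2]

theorem HsetMap_pcone {a : S} (ha : IsIdempotentElem a) {D D' : LObj S} (g : D ⟶ D')
    (γ : Hset (principalCone a) D) {w : S} (hw : a * w = w) (hwD : w ∈ D.carrier)
    (hγ : γ.1 = pcone w) :
    (HsetMap (principalCone a) g γ).1 = pcone (S := S) (LObj.apply g ⟨w, hwD⟩ : D'.carrier) := by
  change (principalCone a).star (eta γ ≫ g) = _
  rw [cones_star_eq rfl _ (mem_coneVertex a), LObj.apply_comp]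
  congr 3
  exact Subtype.ext ((apply_eta ha γ hw hγ _).trans hw)

theorem HsetTrans_pcone {a b : S} (ha : IsIdempotentElem a) {D : LObj S}
    (k : coneVertex b ⟶ coneVertex a)
    (γ : Hset (principalCone a) D) {w : S} (hw : a * w = w) (hγ : γ.1 = pcone w) :
    (HsetTrans (principalCone b) k γ).1 =
      pcone ((LObj.apply k ⟨b, mem_coneVertex b⟩ : (coneVertex a).carrier) * w) := by
  change (principalCone b).star (k ≫ eta γ) = _
  rw [cones_star_eq rfl _ (mem_coneVertex b), LObj.apply_comp, apply_eta ha γ hw hγ]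

/-- Objects of the target are literal subsets of X, so values can be compared inside X and no
heterogeneous equality appears. -/
theorem subsetFunctor_ext {C : Type u} [Category.{v} C] {X : Type u'} {F G : C ⥤ SubsetCat X}
    (h : ∀ d, (F.obj d).carrier = (G.obj d).carrier)
    (hm : ∀ {d d' : C} (g : d ⟶ d') (x : (F.obj d).carrier) (y : (G.obj d).carrier),
      (x : X) = y → (F.map g x : X) = G.map g y) : F = G := by
  obtain ⟨O, M, h1, h2⟩ := F
  obtain ⟨O', M', h1', h2'⟩ := G
  have hO : O = O' := funext fun d => by
    have : (O d).carrier = (O' d).carrier := h d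
    generalize O d = A, O' d = B at this
    cases A; cases B; cases this; rfl
  subst hO
  have hM : @M = @M' := by
    funext d d' g
    exact funext fun x => Subtype.ext (hm g x x rfl)
  subst hM
  rfl

theorem H_congr {C : Type u} [Category.{v} C] [HasInclusions C] [FactorizationCategory C]
    {c c' : C} {ε : ConeAt c} {ε' : ConeAt c'} (h : (⟨c, ε⟩ : Cones C) = ⟨c', ε'⟩)
    (hε : ε.IsIdem) (hε' : ε'.IsIdem) : H ε hε = H ε' hε' := by
  cases h; rfl

/-- The set aS ∩ D depends only on the right ideal aS, which is why Γ_S does not depend on chosen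
generators. -/
theorem H_eq_of_greenR {a b : S} (ha : IsIdempotentElem a) (hb : IsIdempotentElem b)
    (h1 : a * b = b) (h2 : b * a = a) :
    H (principalCone a) (principalCone_isIdem ha) =
      H (principalCone b) (principalCone_isIdem hb) := by
  have key : ∀ {w : S}, a * w = w ↔ b * w = w := fun {w} =>
    ⟨fun h => by rw [← h, ← mul_assoc, h2], fun h => by rw [← h, ← mul_assoc, h1]⟩
  refine subsetFunctor_ext (fun D => Set.ext fun γ => ?_) (fun {D D'} g x y hxy => ?_)
  · change γ ∈ Hset (principalCone a) D ↔ γ ∈ Hset (principalCone b) D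
    simp only [mem_Hset_iff ha, mem_Hset_iff hb, key]
  · obtain ⟨w, hw, haw, hx⟩ := (mem_Hset_iff ha).1 x.2
    exact (HsetMap_pcone ha g x haw hw hx).trans
      (HsetMap_pcone hb g y (key.1 haw) hw (hxy.symm.trans hx)).symm

end PrincipalCones

theorem isConsistentCategory_LObj (S : Type u) [Semigroup S] [Concordant S] : IsConsistentCategory (LObj S) where
  consistent := isConsistentMorphism_of_isBimorphism
  normal := hasNormalFactorization_incl_retraction
  cone c := by
    have h : coneVertex c.gen = c := LObj.ext (by rw [coneVertex_carrier c.gen_idem, c.carrier_eq])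
    have h' : ∃ ε : ConeAt (coneVertex c.gen), ε.app (coneVertex c.gen) = 𝟙 _ :=
      ⟨_, (ConeAt.isIdem_iff _).1 (principalCone_isIdem c.gen_idem)⟩
    rwa [h] at h'

/-! ### A criterion for local isomorphisms. -/

section LocalIso

/-- For a fully faithful functor that is bijective on subobjects, inclusions and retractions in ⟨F
c⟩ lift, so the bijection on morphisms follows. Only uniqueness of inclusions is needed in D, so the
dual need not be shown to be a category with subobjects. -/
theorem isLocalIso_of_obj_bij {C : Type u} [Category.{v} C] [HasInclusions C] {D : Type u'}
    [Category.{v'} D] [HasInclusions D] [CategoryWithSubobjects C] (F : C ⥤ D)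
    (huniq : ∀ {a b : D} (f g : a ⟶ b), IsIncl f → IsIncl g → f = g)
    (map_incl : ∀ {a b : C} (j : a ⟶ b), IsIncl j → IsIncl (F.map j))
    [F.Full] [F.Faithful]
    (obj_bij : ∀ (c : C), Set.BijOn F.obj {a | Sub a c} {x | Sub x (F.obj c)}) :
    IsLocalIso F where
  map_incl := map_incl
  full := inferInstance
  faithful := inferInstance
  obj_bij := obj_bij
  hom_bij c a b ha hb := by
    -- An inclusion F a → F b comes from some a' ⊆ b with F a' = F a, and injectivity on the
    -- subobjects of c gives a' = a.
    have reflect : ∀ {a b : C}, Sub a c → Sub b c → ∀ j : F.obj a ⟶ F.obj b, IsIncl j →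
        ∃ i : a ⟶ b, IsIncl i ∧ F.map i = j := by
      intro a b ha hb j hj
      obtain ⟨a', ha', haa⟩ := (obj_bij b).surjOn (show Sub (F.obj a) (F.obj b) from ⟨j, hj⟩)
      obtain ⟨i, hi⟩ := ha'
      obtain ⟨k, hk⟩ := hb
      have : a' = a := (obj_bij c).injOn
        ⟨i ≫ k, CategoryWithSubobjects.incl_comp _ _ hi hk⟩ ha haa
      subst this
      exact ⟨i, hi, huniq _ _ (map_incl i hi) hj⟩
    have msub : ∀ {a : C}, Sub a c → Sub (F.obj a) (F.obj c) := fun ⟨j, hj⟩ => ⟨_, map_incl j hj⟩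
    refine ⟨fun f hf => ?_, fun f _ g _ h => F.map_injective h, fun g hg => ?_⟩
    · clear ha hb
      change InCore c f at hf
      change InCore (F.obj c) (F.map f)
      induction hf with
      | incl j h1 h2 h3 => exact .incl _ (msub h1) (msub h2) (map_incl j h3)
      | retraction q h1 h2 h3 =>
        obtain ⟨j, hj, hjq⟩ := h3
        exact .retraction _ (msub h1) (msub h2)
          ⟨F.map j, map_incl j hj, by rw [← F.map_comp, hjq, F.map_id]⟩
      | comp f g _ _ ihf ihg => rw [F.map_comp]; exact .comp _ _ ihf ihg
    -- The endpoints are generalized to arbitrary objects of D because the middle object of a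
    -- composite is only known to be a subobject of F c; surjectivity on subobjects lifts it.
    · have key : ∀ {x y : D} (g : x ⟶ y), InCore (F.obj c) g → ∀ (a b : C) (hx : F.obj a = x)
          (hy : F.obj b = y), Sub a c → Sub b c →
          ∃ f : a ⟶ b, InCore c f ∧ F.map f = eqToHom hx ≫ g ≫ eqToHom hy.symm := by
        intro x y g hg
        induction hg with
        | incl j _ _ h3 =>
          rintro a b rfl rfl ha hb
          obtain ⟨i, hi, hij⟩ := reflect ha hb j h3
          exact ⟨i, .incl i ha hb hi, by simpa using hij⟩
        | retraction q _ _ h3 =>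
          rintro a b rfl rfl ha hb
          obtain ⟨j, hj, hjq⟩ := h3
          obtain ⟨i, hi, rfl⟩ := reflect hb ha j hj
          refine ⟨F.preimage q, .retraction _ ha hb ⟨i, hi, F.map_injective ?_⟩, by simp⟩
          rw [F.map_comp, F.map_preimage, hjq, F.map_id]
        | comp f g hf hg ihf ihg =>
          rintro a b rfl rfl ha hb
          have hs : ∀ {x y : D} {f : x ⟶ y}, InCore (F.obj c) f → Sub y (F.obj c) := fun h =>
            h.sub.2
          obtain ⟨m, hm, rfl⟩ := (obj_bij c).surjOn (hs hf)
          obtain ⟨f', hf', h1⟩ := ihf a m rfl rfl ha hm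
          obtain ⟨g', hg', h2⟩ := ihg m b rfl rfl hm hb
          refine ⟨f' ≫ g', .comp _ _ hf' hg', ?_⟩
          rw [F.map_comp, h1, h2]
          simp
      obtain ⟨f, hf, h⟩ := key g hg a b rfl rfl ha hb
      exact ⟨f, hf, by simpa using h⟩

end LocalIso

/-! ### The functors Γ_S and Δ_S, treated together by means of an anti-isomorphism. -/

section Gamma

theorem map_idem_of_anti {S T : Type u} [Semigroup S] [Semigroup T] (t : T ≃ S)
    (ht : ∀ x y, t (x * y) = t y * t x) {z : T} : IsIdempotentElem (t z) ↔ IsIdempotentElem z := by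
  change t z * t z = t z ↔ z * z = z
  rw [← ht, t.apply_eq_iff_eq]

variable {S T : Type u} [Semigroup S] [Abundant S] [Semigroup T] (t : T ≃ S)
  (ht : ∀ x y, t (x * y) = t y * t x)

/-- A description by the ideal A alone: the value at D is A ∩ D, read through t. -/
theorem mem_gamma_iff {A : LObj T} {D : LObj S} {γ : Cones (LObj S)} :
    γ ∈ (((gammaFunctor t ht).obj A).functor.obj D).carrier ↔
      ∃ z ∈ A.carrier, t z ∈ D.carrier ∧ γ = pcone (t z) := by
  refine (mem_Hset_iff ((map_idem_of_anti t ht).2 A.gen_idem)).trans ?_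
  constructor
  · rintro ⟨w, hw, haw, rfl⟩
    refine ⟨t.symm w, A.mem_iff.2 (t.injective ?_), by simpa using hw, by simp⟩
    rw [ht, t.apply_symm_apply, haw]
  · rintro ⟨z, hz, hzD, rfl⟩
    exact ⟨t z, hzD, by rw [← ht, A.mem_iff.1 hz], rfl⟩

theorem gamma_map_apply {A B : LObj T} (φ : A ⟶ B) {D : LObj S}
    (x : (((gammaFunctor t ht).obj A).functor.obj D).carrier) {z : T} (hz : z ∈ A.carrier)
    (hx : x.1 = pcone (t z)) :
    (NatTrans.app (F := ((gammaFunctor t ht).obj A).functor)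
      (G := ((gammaFunctor t ht).obj B).functor) ((gammaFunctor t ht).map φ) D x).1 =
      pcone (t (LObj.apply φ ⟨z, hz⟩ : B.carrier)) := by
  refine (HsetTrans_pcone ((map_idem_of_anti t ht).2 A.gen_idem) _ x
    (by rw [← ht, A.mem_iff.1 hz]) hx).trans ?_
  rw [LObj.apply_rho, ← ht, ← ht, B.mem_iff.1 (LObj.coef_mem φ), LObj.apply_eq]

theorem gamma_obj_map {A : LObj T} {D D' : LObj S} (g : D ⟶ D')
    (x : (((gammaFunctor t ht).obj A).functor.obj D).carrier) {z : T} (hz : z ∈ A.carrier)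
    (hzD : t z ∈ D.carrier) (hx : x.1 = pcone (t z)) :
    ((((gammaFunctor t ht).obj A).functor.map g) x).1 =
      pcone (S := S) (LObj.apply g ⟨t z, hzD⟩ : D'.carrier) :=
  HsetMap_pcone ((map_idem_of_anti t ht).2 A.gen_idem) g x (by rw [← ht, A.mem_iff.1 hz]) hzD hx

include ht in
theorem pcone_injOn_carrier {A : LObj T} {z z' : T} (hz : z ∈ A.carrier) (hz' : z' ∈ A.carrier)
    (h : pcone (t z) = pcone (t z')) : z = z' :=
  t.injective (pcone_injOn ((map_idem_of_anti t ht).2 A.gen_idem)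
    (by rw [← ht, A.mem_iff.1 hz]) (by rw [← ht, A.mem_iff.1 hz']) h)

theorem dual_hom_ext {C : Type u} [Category.{v} C] [HasInclusions C] [FactorizationCategory C]
    {F G : Dual C} {σ τ : F ⟶ G} (h : ∀ (c : C) (x : (F.functor.obj c).carrier),
      (NatTrans.app (F := F.functor) (G := G.functor) σ c x).1 =
        (NatTrans.app (F := F.functor) (G := G.functor) τ c x).1) : σ = τ :=
  NatTrans.ext (F := F.functor) (G := G.functor)
    (funext fun c => funext fun x => Subtype.ext (h c x))

theorem dual_subset {C : Type u} [Category.{v} C] [HasInclusions C] [FactorizationCategory C]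
    {F G : Dual C} (h : Sub F G) (c : C) :
    (F.functor.obj c).carrier ⊆ (G.functor.obj c).carrier := fun x hx => by
  obtain ⟨j, hj⟩ := h
  have := (NatTrans.app (F := F.functor) (G := G.functor) j c ⟨x, hx⟩).2
  rwa [hj c ⟨x, hx⟩] at this

theorem dual_ext {C : Type u} [Category.{v} C] [HasInclusions C] [FactorizationCategory C]
    {F G : Dual C} (h : F.functor = G.functor) : F = G := by
  cases F; cases G; cases h; rfl

theorem represents_of_gen {A : LObj T} {z : T} (hz : IsIdempotentElem z)
    (hA : A.carrier = leftIdeal z) {c : LObj S} {ε : ConeAt c}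
    (h : (⟨c, ε⟩ : Cones (LObj S)) = pcone (t z)) :
    Represents ((gammaFunctor t ht).obj A) ε := by
  have htz := (map_idem_of_anti t ht).2 hz
  have hε : ε.IsIdem := by
    have := principalCone_isIdem htz
    change IsIdempotentElem (pcone (t z)) at this
    rwa [← h] at this
  refine ⟨hε, ?_⟩
  rw [H_congr (ε' := principalCone (t z)) h hε (principalCone_isIdem htz)]
  have h1 := A.carrier_eq
  rw [hA, leftIdeal_eq_iff hz A.gen_idem] at h1
  exact H_eq_of_greenR ((map_idem_of_anti t ht).2 A.gen_idem) htz (by rw [← ht, h1.1]) (by rw [← ht, h1.2])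

/-- The cone ε = ε * 1 lies in H(ε; c), hence in the value of Γ(A), so it is principal; ε(c) = 1
evaluated at its element gives idempotency. Allowing F below Γ(A) also serves surjectivity on
subobjects. -/
theorem exists_gen_of_represents_sub {A : LObj T} {F : Dual (LObj S)}
    (hF : ∀ D, (F.functor.obj D).carrier ⊆
      (((gammaFunctor t ht).obj A).functor.obj D).carrier)
    {c : LObj S} {ε : ConeAt c} (h : Represents F ε) :
    ∃ z ∈ A.carrier, IsIdempotentElem z ∧ (⟨c, ε⟩ : Cones (LObj S)) = pcone (t z) := by
  obtain ⟨hε, h⟩ := h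
  have h1 : (⟨c, ε⟩ : Cones (LObj S)) ∈ (F.functor.obj c).carrier := by
    rw [h]; exact ⟨𝟙 c, (cone_star_id ε).symm⟩
  obtain ⟨z, hz, hzc, hzε⟩ := (mem_gamma_iff t ht).1 (hF c h1)
  refine ⟨z, hz, ?_, hzε⟩
  rw [← map_idem_of_anti t ht]
  rw [ConeAt.isIdem_iff] at hε
  cases hzε
  exact congrArg (fun ψ => (LObj.apply ψ ⟨t z, hzc⟩ : S)) hε

theorem represents_iff {A : LObj T} {c : LObj S} {ε : ConeAt c} :
    Represents ((gammaFunctor t ht).obj A) ε ↔ ∃ z, IsIdempotentElem z ∧ A.carrier = leftIdeal z ∧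
      (⟨c, ε⟩ : Cones (LObj S)) = pcone (t z) := by
  constructor
  · intro h
    obtain ⟨z, hzA, hz, hzε⟩ := exists_gen_of_represents_sub t ht (fun _ => subset_rfl) h
    refine ⟨z, hz, ?_, hzε⟩
    have htz := (map_idem_of_anti t ht).2 hz
    obtain ⟨hε, h⟩ := h
    rw [H_congr (ε' := principalCone (t z)) hzε hε (principalCone_isIdem htz)] at h
    -- Half of A = Tz is z ∈ A. For the other half, the cone of `t A.gen` lies in H(ρ; D) for ρ the
    -- cone of `t z`, which puts `A.gen` in Tz.
    obtain ⟨D, hD⟩ := exists_mem_LObj (t A.gen)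
    have h1 : pcone (t A.gen) ∈ (((gammaFunctor t ht).obj A).functor.obj D).carrier :=
      (mem_gamma_iff t ht).2 ⟨_, A.gen_mem, hD, rfl⟩
    rw [h] at h1
    obtain ⟨w, hw, hzw, hwA⟩ := (mem_Hset_iff htz).1 h1
    have h2 : t.symm w * z = t.symm w := t.injective (by rw [ht, t.apply_symm_apply, hzw])
    have h3 : A.gen = t.symm w := pcone_injOn_carrier t ht A.gen_mem
      (by rw [← h2]; exact A.mul_mem _ hzA) (by rwa [t.apply_symm_apply])
    rw [A.carrier_eq, leftIdeal_eq_iff A.gen_idem hz]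
    exact ⟨by rw [h3, h2], A.mem_iff.1 hzA⟩
  · rintro ⟨z, hz, hA, h⟩
    exact represents_of_gen t ht hz hA h

/-- Yoneda: Γ(A) is generated by the cone of `t A.gen`, so a natural transformation is determined by
the image of this cone, and any such image is realized by a right multiplication. -/
theorem isLocalIso_gammaFunctor : IsLocalIso (gammaFunctor t ht) := by
  have hfull : (gammaFunctor t ht).Full := ⟨fun {A B} τ => by
    have hD : t A.gen ∈ (LObj.of (t A.gen) ((map_idem_of_anti t ht).2 A.gen_idem)).carrier :=
      LObj.mem_of.2 ((map_idem_of_anti t ht).2 A.gen_idem)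
    generalize LObj.of (t A.gen) ((map_idem_of_anti t ht).2 A.gen_idem) = D₀ at hD
    let x₀ : (((gammaFunctor t ht).obj A).functor.obj D₀).carrier :=
      ⟨pcone (t A.gen), (mem_gamma_iff t ht).2 ⟨_, A.gen_mem, hD, rfl⟩⟩
    let y₀ := NatTrans.app (F := ((gammaFunctor t ht).obj A).functor)
      (G := ((gammaFunctor t ht).obj B).functor) τ D₀ x₀
    obtain ⟨z₁, hz₁, hz₁D, hy₀⟩ := (mem_gamma_iff t ht).1 y₀.2
    refine ⟨rho z₁ fun x _ => B.mul_mem x hz₁, dual_hom_ext fun D x => ?_⟩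
    obtain ⟨z, hz, hzD, hx⟩ := (mem_gamma_iff t ht).1 x.2
    rw [gamma_map_apply t ht _ x hz hx, LObj.apply_rho]
    -- Multiplication by t z carries the universal element to x; naturality along it computes τ at
    -- x.
    let g : D₀ ⟶ D := rho (t z) fun s _ => D.mul_mem s hzD
    have h1 : (((gammaFunctor t ht).obj A).functor.map g) x₀ = x := Subtype.ext (by
      rw [gamma_obj_map t ht g x₀ A.gen_mem hD rfl, hx, LObj.apply_rho, ← ht, A.mem_iff.1 hz])
    have h2 := NatTrans.naturality (F := ((gammaFunctor t ht).obj A).functor)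
      (G := ((gammaFunctor t ht).obj B).functor) τ g
    have h3 := congrArg Subtype.val (congrFun h2 x₀)
    change (NatTrans.app (F := ((gammaFunctor t ht).obj A).functor)
      (G := ((gammaFunctor t ht).obj B).functor) τ D
        ((((gammaFunctor t ht).obj A).functor.map g) x₀)).1 =
      ((((gammaFunctor t ht).obj B).functor.map g) y₀).1 at h3
    rw [h1, gamma_obj_map t ht g y₀ hz₁ hz₁D hy₀, LObj.apply_rho, ← ht] at h3
    exact h3.symm⟩
  have hfaith : (gammaFunctor t ht).Faithful := ⟨fun {A B φ ψ} h => LObj.hom_ext fun z => by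
    obtain ⟨D, hD⟩ := exists_mem_LObj (t z)
    let x : (((gammaFunctor t ht).obj A).functor.obj D).carrier :=
      ⟨pcone (t z), (mem_gamma_iff t ht).2 ⟨_, z.2, hD, rfl⟩⟩
    refine pcone_injOn_carrier t ht (LObj.apply φ z).2 (LObj.apply ψ z).2 ?_
    exact (gamma_map_apply t ht φ x z.2 rfl).symm.trans ((congrArg (fun σ =>
      (NatTrans.app (F := ((gammaFunctor t ht).obj A).functor)
        (G := ((gammaFunctor t ht).obj B).functor) σ D x).1) h).trans
      (gamma_map_apply t ht ψ x z.2 rfl))⟩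
  have hincl : ∀ {A B : LObj T} (j : A ⟶ B), IsIncl j → IsIncl ((gammaFunctor t ht).map j) := by
    intro A B j hj D x
    obtain ⟨z, hz, hzD, hx⟩ := (mem_gamma_iff t ht).1 x.2
    rw [gamma_map_apply t ht j x hz hx, hx, hj]
  refine isLocalIso_of_obj_bij _ (fun f g hf hg => dual_hom_ext fun c x =>
    (hf c x).trans (hg c x).symm) hincl
    fun A => ⟨?_, ?_, ?_⟩
  · rintro B ⟨j, hj⟩
    exact ⟨_, hincl j hj⟩
  · have key : ∀ {B B' : LObj T}, Sub B A → Sub B' A →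
        (gammaFunctor t ht).obj B = (gammaFunctor t ht).obj B' → B.carrier ⊆ B'.carrier := by
      intro B B' hB hB' h z hz
      obtain ⟨D, hD⟩ := exists_mem_LObj (t z)
      have h1 := (mem_gamma_iff t ht).2 ⟨z, hz, hD, rfl⟩
      rw [h] at h1
      obtain ⟨z', hz', -, hzz⟩ := (mem_gamma_iff t ht).1 h1
      rwa [pcone_injOn_carrier t ht (LObj.subset_of_sub hB hz) (LObj.subset_of_sub hB' hz') hzz]
    intro B hB B' hB' h
    exact LObj.ext ((key hB hB' h).antisymm (key hB' hB h.symm))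
  -- An `H`-functor below Γ(A) is represented by the cone of an idempotent z ∈ A, so it is Γ(Tz).
  · intro F hF
    obtain ⟨c, ε, hε, hFε⟩ := F.isH
    obtain ⟨z, hzA, hz, hzε⟩ := exists_gen_of_represents_sub t ht (dual_subset hF)
      (ε := ε) ⟨hε, hFε⟩
    refine ⟨LObj.of z hz, LObj.sub_iff.2 fun x hx => ?_, dual_ext ?_⟩
    · rw [← LObj.mem_of.1 hx]; exact A.mul_mem _ hzA
    · obtain ⟨_, h⟩ := represents_of_gen t ht (A := LObj.of z hz) hz rfl hzε
      rw [h, hFε]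

theorem mem_MSet_gamma_iff {A : LObj T} {c : LObj S} :
    c ∈ MSet ((gammaFunctor t ht).obj A) ↔ ∃ z, IsIdempotentElem z ∧ A.carrier = leftIdeal z ∧
      c.carrier = leftIdeal (t z) := by
  constructor
  · rintro ⟨d, ε, hε, hiso⟩
    obtain ⟨z, hz, hA, hzε⟩ := (represents_iff t ht).1 hε
    have htz := (map_idem_of_anti t ht).2 hz
    cases hzε
    obtain ⟨ψ, h1, h2⟩ := hiso
    have hw := mem_coneVertex (t z)
    -- The inverse ψ sends t z to an idempotent v that generates c and is R-related to t z; its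
    -- preimage under t still generates A.
    obtain ⟨v, hv⟩ : ∃ v : S, v = (LObj.apply ψ ⟨t z, hw⟩ : c.carrier) := ⟨_, rfl⟩
    have hvc : v ∈ c.carrier := by rw [hv]; exact Subtype.prop _
    have hψ : ∀ y : (coneVertex (t z)).carrier, (LObj.apply ψ y : S) = y * v := fun y => by
      rw [hv, LObj.apply_eq_mul ψ hw y ((LObj.mem_of_carrier htz (coneVertex_carrier htz)).1 y.2)]
    have hwv : t z * v = v := by rw [hv, mul_apply_gen ψ hw htz]
    have hxv : ∀ x ∈ c.carrier, x * v = x := fun x hx => by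
      have := congrArg (fun χ => (LObj.apply χ ⟨x, hx⟩ : S)) h1
      simp only [LObj.apply_comp, hψ] at this
      change x * t z * v = x at this
      rwa [mul_assoc, hwv] at this
    have hvw : v * t z = t z := by
      have := congrArg (fun χ => (LObj.apply χ ⟨t z, hw⟩ : S)) h2
      simp only [LObj.apply_comp] at this
      change (LObj.apply ψ ⟨t z, hw⟩ : S) * t z = t z at this
      rwa [← hv] at this
    have hvi : IsIdempotentElem v := hxv v hvc
    have hzi : IsIdempotentElem (t.symm v) := by
      rw [← map_idem_of_anti t ht, t.apply_symm_apply]; exact hvi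
    refine ⟨t.symm v, hzi, ?_, ?_⟩
    · rw [hA, leftIdeal_eq_iff hz hzi]
      exact ⟨t.injective (by rw [ht, t.apply_symm_apply, hvw]),
        t.injective (by rw [ht, t.apply_symm_apply, hwv])⟩
    · rw [t.apply_symm_apply]
      ext x
      rw [mem_leftIdeal hvi]
      exact ⟨hxv x, fun h => by rw [← h]; exact c.mul_mem _ hvc⟩
  · rintro ⟨z, hz, hA, hc⟩
    have htz := (map_idem_of_anti t ht).2 hz
    have h : c = coneVertex (t z) := LObj.ext (by rw [hc, coneVertex_carrier htz])
    subst h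
    refine ⟨_, principalCone (t z), represents_of_gen t ht hz hA rfl, ?_⟩
    rw [(ConeAt.isIdem_iff _).1 (principalCone_isIdem htz)]
    infer_instance

end Gamma

/-! ### The cross-connection ΩS and its linked pairs. -/

section OmegaS

/-- An idempotent is determined by the left ideal and the right ideal that it generates. -/
theorem idem_ext {S : Type u} [Semigroup S] {k l : S} (hk : IsIdempotentElem k) (hl : IsIdempotentElem l)
    (h1 : leftIdeal k = leftIdeal l) (h2 : leftIdeal (op k) = leftIdeal (op l)) : k = l := by
  rw [leftIdeal_eq_iff hk hl] at h1
  rw [leftIdeal_eq_iff (congrArg op hk) (congrArg op hl)] at h2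
  exact (congrArg unop h2.1).symm.trans h1.2

variable {S : Type u} [Semigroup S] [Abundant S]

theorem vertex_of_pcone_eq {c : LObj S} {γ : ConeAt c} {k : S} (hk : IsIdempotentElem k)
    (h : (⟨c, γ⟩ : Cones (LObj S)) = pcone k) : c.carrier = leftIdeal k := by
  cases h; exact coneVertex_carrier hk

theorem apply_of_pcone_eq {c : LObj S} {γ : ConeAt c} {k : S}
    (h : (⟨c, γ⟩ : Cones (LObj S)) = pcone k) (A : LObj S) (x : A.carrier) :
    (LObj.apply (γ.app A) x : S) = x * k := by
  cases h; rfl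

theorem exists_cone_eq_pcone {c : LObj S} {k : S} (hk : IsIdempotentElem k)
    (hc : c.carrier = leftIdeal k) : ∃ γ : ConeAt c, (⟨c, γ⟩ : Cones (LObj S)) = pcone k := by
  have h : c = coneVertex k := LObj.ext (by rw [hc, coneVertex_carrier hk])
  subst h
  exact ⟨_, rfl⟩

theorem isGamma_Omega_iff {c : LObj S} {d : RObj S} {γ : ConeAt c} :
    (Omega S).IsGamma c d γ ↔ ∃ k : S, IsIdempotentElem k ∧ d.carrier = leftIdeal (op k) ∧
      (⟨c, γ⟩ : Cones (LObj S)) = pcone k := by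
  refine (represents_iff (S := S) (T := Sᵐᵒᵖ) opEquiv.symm fun _ _ => rfl).trans ?_
  exact ⟨fun ⟨z, hz, h⟩ => ⟨unop z, congrArg unop hz, h⟩, fun ⟨k, hk, h⟩ => ⟨op k, congrArg op hk, h⟩⟩

theorem isDelta_Omega_iff {c : LObj S} {d : RObj S} {δ : ConeAt d} :
    (Omega S).IsDelta c d δ ↔ ∃ k : S, IsIdempotentElem k ∧ c.carrier = leftIdeal k ∧
      (⟨d, δ⟩ : Cones (RObj S)) = pcone (op k) :=
  represents_iff (S := Sᵐᵒᵖ) (T := S) opEquiv fun _ _ => rfl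

theorem mem_MSet_Γ_Omega_iff {c : LObj S} {d : RObj S} :
    c ∈ MSet ((Omega S).Γ.obj d) ↔ ∃ k : S, IsIdempotentElem k ∧ c.carrier = leftIdeal k ∧
      d.carrier = leftIdeal (op k) := by
  refine (mem_MSet_gamma_iff (S := S) (T := Sᵐᵒᵖ) opEquiv.symm fun _ _ => rfl).trans ?_
  exact ⟨fun ⟨z, hz, h1, h2⟩ => ⟨unop z, congrArg unop hz, h2, h1⟩,
    fun ⟨k, hk, h1, h2⟩ => ⟨op k, congrArg op hk, h2, h1⟩⟩

theorem mem_MSet_Δ_Omega_iff {c : LObj S} {d : RObj S} :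
    d ∈ MSet ((Omega S).Δ.obj c) ↔ ∃ k : S, IsIdempotentElem k ∧ c.carrier = leftIdeal k ∧
      d.carrier = leftIdeal (op k) :=
  mem_MSet_gamma_iff (S := Sᵐᵒᵖ) (T := S) opEquiv fun _ _ => rfl

/-- The two `M`-set conditions coincide because each says that c = Sk and d = kS for some idempotent
k. -/
theorem isCrossConnection_Omega (S : Type u) [Semigroup S] [Concordant S] :
    (Omega S).IsCrossConnection where
  left := isConsistentCategory_LObj S
  right := isConsistentCategory_LObj Sᵐᵒᵖ
  localIso_Γ := isLocalIso_gammaFunctor _ fun _ _ => rfl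
  localIso_Δ := isLocalIso_gammaFunctor _ fun _ _ => rfl
  mem_iff _ _ := mem_MSet_Γ_Omega_iff.trans mem_MSet_Δ_Omega_iff.symm

/-- `f = ρ(k₁,u,k₂)` and `g = λ(k₂,u,k₁)`. -/
structure TransposeBy {S : Type u} [Semigroup S] {c₁ c₂ : LObj S} {d₁ d₂ : RObj S} (f : c₁ ⟶ c₂)
    (g : d₂ ⟶ d₁) (k₁ k₂ u : S) : Prop where
  idem₁ : IsIdempotentElem k₁
  idem₂ : IsIdempotentElem k₂
  left₁ : c₁.carrier = leftIdeal k₁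
  left₂ : c₂.carrier = leftIdeal k₂
  right₁ : d₁.carrier = leftIdeal (op k₁)
  right₂ : d₂.carrier = leftIdeal (op k₂)
  mul_left : k₁ * u = u
  mul_right : u * k₂ = u
  left : ∀ x : c₁.carrier, (LObj.apply f x : S) = x * u
  right : ∀ y : d₂.carrier, (LObj.apply g y : Sᵐᵒᵖ) = y * op u

/-- Δ(f) acts on cones as f acts on elements, while g acts by precomposition. Comparing the two on
the generator yields f(k₁) = g(k₂) in S, and this common element is u. -/
theorem isTranspose_Omega_iff {c₁ c₂ : LObj S} {d₁ d₂ : RObj S} {f : c₁ ⟶ c₂} {g : d₂ ⟶ d₁} :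
    (Omega S).IsTranspose f g ↔ ∃ k₁ k₂ u : S, TransposeBy f g k₁ k₂ u := by
  constructor
  · rintro ⟨δ₁, δ₂, h₁, h₂, h⟩
    obtain ⟨k₁, hk₁, hc₁, hd₁⟩ := isDelta_Omega_iff.1 h₁
    obtain ⟨k₂, hk₂, hc₂, hd₂⟩ := isDelta_Omega_iff.1 h₂
    have hok₁ : IsIdempotentElem (op k₁) := congrArg op hk₁
    have hok₂ : IsIdempotentElem (op k₂) := congrArg op hk₂
    have hr₁ := vertex_of_pcone_eq hok₁ hd₁
    have hr₂ := vertex_of_pcone_eq hok₂ hd₂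
    have hm₁ : k₁ ∈ c₁.carrier := (LObj.mem_of_carrier hk₁ hc₁).2 hk₁
    have hm₁' : op k₁ ∈ d₁.carrier := (LObj.mem_of_carrier hok₁ hr₁).2 hok₁
    have hm₂' : op k₂ ∈ d₂.carrier := (LObj.mem_of_carrier hok₂ hr₂).2 hok₂
    let x : (((Omega S).Δ.obj c₁).functor.obj d₁).carrier := ⟨pcone (op k₁),
      (mem_gamma_iff (S := Sᵐᵒᵖ) (T := S) opEquiv fun _ _ => rfl).2 ⟨k₁, hm₁, hm₁', rfl⟩⟩
    -- The universal element is the case h = 1.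
    have h3 := h d₁ (𝟙 d₁) x (by rw [cone_star_id, hd₁])
    have h4 := gamma_map_apply (S := Sᵐᵒᵖ) (T := S) opEquiv (fun _ _ => rfl) f x hm₁ rfl
    obtain ⟨u, hu⟩ : ∃ u : S, u = (LObj.apply f ⟨k₁, hm₁⟩ : c₂.carrier) := ⟨_, rfl⟩
    obtain ⟨v, hv⟩ : ∃ v : Sᵐᵒᵖ, v = (LObj.apply g ⟨op k₂, hm₂'⟩ : d₁.carrier) := ⟨_, rfl⟩
    have huc : u ∈ c₂.carrier := by rw [hu]; exact Subtype.prop _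
    have hvc : unop v ∈ c₂.carrier := by
      rw [LObj.mem_of_carrier hk₂ hc₂, hv]
      exact congrArg unop (mul_apply_gen g hm₂' hok₂)
    rw [← hu] at h4
    rw [Category.comp_id, cones_star_eq hd₂ g hm₂', ← hv] at h3
    have huv : u = unop v := pcone_injOn_carrier (S := Sᵐᵒᵖ) (T := S) opEquiv (fun _ _ => rfl)
      huc hvc (h4.symm.trans h3)
    refine ⟨k₁, k₂, u, hk₁, hk₂, hc₁, hc₂, hr₁, hr₂, ?_, ?_, fun x => ?_, fun y => ?_⟩
    · rw [hu, mul_apply_gen f hm₁ hk₁]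
    · exact (LObj.mem_of_carrier hk₂ hc₂).1 huc
    · rw [hu, LObj.apply_eq_mul f hm₁ x ((LObj.mem_of_carrier hk₁ hc₁).1 x.2)]
    · rw [huv, op_unop, hv, LObj.apply_eq_mul g hm₂' y ((LObj.mem_of_carrier hok₂ hr₂).1 y.2)]
  · rintro ⟨k₁, k₂, u, hk₁, hk₂, hc₁, hc₂, hr₁, hr₂, hu₁, hu₂, hf, hg⟩
    have hok₁ : IsIdempotentElem (op k₁) := congrArg op hk₁
    have hok₂ : IsIdempotentElem (op k₂) := congrArg op hk₂
    obtain ⟨δ₁, hδ₁⟩ := exists_cone_eq_pcone hok₁ hr₁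
    obtain ⟨δ₂, hδ₂⟩ := exists_cone_eq_pcone hok₂ hr₂
    refine ⟨δ₁, δ₂, isDelta_Omega_iff.2 ⟨k₁, hk₁, hc₁, hδ₁⟩,
      isDelta_Omega_iff.2 ⟨k₂, hk₂, hc₂, hδ₂⟩, fun d h x hx => ?_⟩
    have hm₁' : op k₁ ∈ d₁.carrier := (LObj.mem_of_carrier hok₁ hr₁).2 hok₁
    have hm₂' : op k₂ ∈ d₂.carrier := (LObj.mem_of_carrier hok₂ hr₂).2 hok₂
    rw [cones_star_eq hδ₁ h hm₁'] at hx
    rw [cones_star_eq hδ₂ _ hm₂', LObj.apply_comp]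
    obtain ⟨z, hz⟩ : ∃ z : Sᵐᵒᵖ, z = (LObj.apply h ⟨op k₁, hm₁'⟩ : d.carrier) := ⟨_, rfl⟩
    have hzc : unop z ∈ c₁.carrier := by
      rw [LObj.mem_of_carrier hk₁ hc₁, hz]
      exact congrArg unop (mul_apply_gen h hm₁' hok₁)
    have hgk : (LObj.apply g ⟨op k₂, hm₂'⟩ : Sᵐᵒᵖ) = op u :=
      (hg _).trans (congrArg op hu₂)
    refine (gamma_map_apply (S := Sᵐᵒᵖ) (T := S) opEquiv (fun _ _ => rfl) f x hzc
      (by rw [hx, ← hz]; rfl)).trans ?_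
    congr 1
    rw [LObj.apply_eq_mul h hm₁' _ (by rw [hgk, ← op_mul, hu₁]), hgk, ← hz, hf]
    rfl

theorem TransposeBy.star {c₁ c₂ : LObj S} {d₁ d₂ : RObj S} {f : c₁ ⟶ c₂} {g : d₂ ⟶ d₁}
    {k₁ k₂ u : S} (h : TransposeBy f g k₁ k₂ u) {γ : ConeAt c₁} {δ : ConeAt d₂}
    (hγ : (Omega S).IsGamma c₁ d₁ γ) (hδ : (Omega S).IsDelta c₂ d₂ δ) :
    γ.star f = pcone u ∧ δ.star g = pcone (op u) := by
  obtain ⟨p, hp, hp1, hp2⟩ := isGamma_Omega_iff.1 hγ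
  obtain ⟨q, hq, hq1, hq2⟩ := isDelta_Omega_iff.1 hδ
  -- The cones come with their own idempotents, but these generate the same left and right ideals as
  -- k₁ and k₂.
  have hpk : p = k₁ := idem_ext hp h.idem₁
    ((vertex_of_pcone_eq hp hp2).symm.trans h.left₁) (hp1.symm.trans h.right₁)
  have hqk : q = k₂ := idem_ext hq h.idem₂ (hq1.symm.trans h.left₂)
    ((vertex_of_pcone_eq (k := op q) (congrArg op hq) hq2).symm.trans h.right₂)
  subst hpk hqk
  constructor
  · rw [cones_star_eq hp2 f ((LObj.mem_of_carrier hp h.left₁).2 hp), h.left, h.mul_left]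
  · have hoq : IsIdempotentElem (op q) := congrArg op hq
    rw [cones_star_eq hq2 g ((LObj.mem_of_carrier hoq h.right₂).2 hoq), h.right, ← op_mul,
      h.mul_right]

/-- With e R* a L* f, multiplication by a from Se to Sf is a bimorphism, so every principal pair has
a presentation of the kind required in the definition of 𝕊m. -/
theorem exists_transposeBy (a : S) : ∃ (c₁ c₂ : LObj S) (d₁ d₂ : RObj S) (f : c₁ ⟶ c₂)
    (g : d₂ ⟶ d₁) (k₁ k₂ : S), TransposeBy f g k₁ k₂ a ∧ IsBimorphism f := by
  obtain ⟨e, he, hae⟩ := Abundant.exists_rstar a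
  obtain ⟨f, hf, haf⟩ := Abundant.exists_lstar a
  have hoe : IsIdempotentElem (op e) := congrArg op he
  have hof : IsIdempotentElem (op f) := congrArg op hf
  refine ⟨LObj.of e he, LObj.of f hf, LObj.of (op e) hoe, LObj.of (op f) hof,
    rho a fun x _ => LObj.mem_of.2 (by rw [mul_assoc, haf.mul_eq hf]),
    rho (op a) fun x _ => LObj.mem_of.2 (by rw [mul_assoc, ← op_mul, hae.eq_mul he]), e, f,
    ⟨he, hf, rfl, rfl, rfl, rfl, hae.eq_mul he, haf.mul_eq hf, fun _ => rfl, fun _ => rfl⟩,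
    isBimorphism_rho he rfl rfl hae haf hf _⟩

theorem TransposeBy.exists_cones {c₁ c₂ : LObj S} {d₁ d₂ : RObj S} {f : c₁ ⟶ c₂} {g : d₂ ⟶ d₁}
    {k₁ k₂ u : S} (h : TransposeBy f g k₁ k₂ u) : ∃ (γ : ConeAt c₁) (δ : ConeAt d₂),
      (Omega S).IsGamma c₁ d₁ γ ∧ (Omega S).IsDelta c₂ d₂ δ := by
  obtain ⟨γ, hγ⟩ := exists_cone_eq_pcone h.idem₁ h.left₁
  obtain ⟨δ, hδ⟩ := exists_cone_eq_pcone (k := op k₂) (congrArg op h.idem₂) h.right₂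
  exact ⟨γ, δ, isGamma_Omega_iff.2 ⟨k₁, h.idem₁, h.right₁, hγ⟩,
    isDelta_Omega_iff.2 ⟨k₂, h.idem₂, h.left₂, hδ⟩⟩

theorem linked_Omega : (Omega S).linked = Set.range (principalPair (S := S)) := by
  ext ⟨γ, δ⟩
  constructor
  · rintro ⟨c, d, c', d', f, g, γ₀, δ₀, hγ₀, hδ₀, hfg, h1, h2⟩
    obtain ⟨k₁, k₂, u, h⟩ := isTranspose_Omega_iff.1 hfg
    obtain ⟨h3, h4⟩ := h.star hγ₀ hδ₀
    exact ⟨u, Prod.ext (h1.trans h3).symm (unop_injective (h2.trans h4).symm)⟩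
  · rintro ⟨a, ha⟩
    obtain ⟨c₁, c₂, d₁, d₂, f, g, k₁, k₂, h, -⟩ := exists_transposeBy a
    obtain ⟨γ₀, δ₀, hγ₀, hδ₀⟩ := h.exists_cones
    obtain ⟨h3, h4⟩ := h.star hγ₀ hδ₀
    rw [← ha]
    exact ⟨c₂, d₁, c₁, d₂, f, g, γ₀, δ₀, hγ₀, hδ₀, isTranspose_Omega_iff.2 ⟨_, _, _, h⟩,
      h3.symm, h4.symm⟩

theorem principalPair_mul (a b : S) :
    principalPair (a * b) = principalPair a * principalPair b :=
  Prod.ext (pcone_mul a b).symm (congrArg op (pcone_mul (op b) (op a)).symm)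

/-- The cones give e a = e b and a e = b e for all idempotents e; taking e R* b and f L* a yields a
= a f = b f = e a f = e a = b. One cone is not enough: in a left zero semigroup all ρᵃ coincide. -/
theorem principalPair_injective : Function.Injective (principalPair (S := S)) := by
  intro a b h
  have h1 : pcone a = pcone b := congrArg Prod.fst h
  have h2 : pcone (op a) = pcone (op b) := congrArg unop (congrArg Prod.snd h)
  have h3 : ∀ {e : S}, IsIdempotentElem e → a * e = b * e := fun {e} he =>
    congrArg unop (eq_mul_of_pcone_eq h2 (e := op e) (congrArg op he))
  obtain ⟨e, he, hbe⟩ := Abundant.exists_rstar b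
  obtain ⟨f, hf, haf⟩ := Abundant.exists_lstar a
  have h4 : e * a = b := by rw [eq_mul_of_pcone_eq h1 he, hbe.eq_mul he]
  calc a = b * f := by rw [← h3 hf, haf.mul_eq hf]
    _ = b := by rw [← h4, mul_assoc, haf.mul_eq hf]

theorem linked_Omega_mul (S : Type u) [Semigroup S] [Abundant S] : ∀ p ∈ (Omega S).linked,
    ∀ q ∈ (Omega S).linked, p * q ∈ (Omega S).linked := by
  rw [linked_Omega]
  rintro _ ⟨a, rfl⟩ _ ⟨b, rfl⟩
  exact ⟨a * b, principalPair_mul a b⟩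

/-- The isomorphism `a ↦ (ρᵃ, λᵃ)`. -/
noncomputable def principalEquiv (S : Type u) [Semigroup S] [Abundant S] :
    S ≃* (Omega S).crossSemigroup (linked_Omega_mul S) where
  __ := Equiv.ofBijective
    (fun a : S => (⟨principalPair a, linked_Omega.ge ⟨a, rfl⟩⟩ :
      (Omega S).crossSemigroup (linked_Omega_mul S)))
    ⟨fun _ _ h => principalPair_injective (congrArg Subtype.val h), fun p => by
      obtain ⟨a, ha⟩ := linked_Omega.le p.2
      exact ⟨a, Subtype.ext ha⟩⟩
  map_mul' a b := Subtype.ext (principalPair_mul a b)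

theorem principalEquiv_apply (a : S) :
    (principalEquiv S a : Cones (LObj S) × (Cones (RObj S))ᵐᵒᵖ) = principalPair a := rfl

end OmegaS

/-! ### The morphism Ωh and the map that it induces on linked pairs. -/

section CCMorphism

variable {S T : Type u} [Semigroup S] [Semigroup T] (h : S →ₙ* T)

theorem leftMap_obj_carrier {A : LObj S} {k : S} (hk : IsIdempotentElem k)
    (hA : A.carrier = leftIdeal k) : ((leftMap h).obj A).carrier = leftIdeal (h k) := by
  have h1 : A = LObj.of k hk := LObj.ext hA
  rw [h1, leftMap_obj_of h hk (hk.map h)]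
  rfl

theorem apply_leftMap_map {A B : LObj S} (φ : A ⟶ B) {u : S}
    (hu : ∀ x : A.carrier, (LObj.apply φ x : S) = x * u) (x : ((leftMap h).obj A).carrier) :
    (LObj.apply ((leftMap h).map φ) x : T) = x * h u := by
  have h1 : LObj.coef φ = A.gen * u := hu ⟨A.gen, A.gen_mem⟩
  have h2 : (x : T) * h A.gen = x := (mem_leftIdeal (A.gen_idem.map h)).1 x.2
  change (x : T) * h (LObj.coef φ) = x * h u
  rw [h1, map_mul, ← mul_assoc, h2]

theorem isIncl_leftMap_map {A B : LObj S} (j : A ⟶ B) (hj : IsIncl j) :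
    IsIncl ((leftMap h).map j) := fun x => by
  rw [apply_leftMap_map h j (u := A.gen) fun y => (hj y).trans (A.mem_iff.1 y.2).symm]
  exact (mem_leftIdeal (A.gen_idem.map h)).1 x.2

/-- The only condition on a CC-morphism that needs h to be good: bimorphisms are recognized by the
relations R* and L* of their multipliers. -/
theorem isBimorphism_leftMap_map [Abundant S] [Abundant T]
    (hL : ∀ a b, LStar a b → LStar (h a) (h b)) (hR : ∀ a b, RStar a b → RStar (h a) (h b))
    {A B : LObj S} (φ : A ⟶ B) (hφ : IsBimorphism φ) : IsBimorphism ((leftMap h).map φ) := by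
  obtain ⟨h1, h2⟩ := (isBimorphism_iff φ A.gen_idem B.gen_idem A.carrier_eq B.carrier_eq
    A.gen_mem).1 hφ
  change RStar (LObj.coef φ) _ at h1
  change LStar (LObj.coef φ) _ at h2
  have hA := A.gen_idem.map h
  have hm : h A.gen ∈ ((leftMap h).obj A).carrier := (mem_leftIdeal hA).2 hA
  have h3 : (LObj.apply ((leftMap h).map φ) ⟨h A.gen, hm⟩ : T) = h (LObj.coef φ) := by
    rw [apply_leftMap_map h φ (LObj.apply_eq φ), ← map_mul, LObj.gen_mul_coef]
  refine (isBimorphism_iff _ hA (B.gen_idem.map h) rfl rfl hm).2 ?_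
  rw [h3]
  exact ⟨hR _ _ h1, hL _ _ h2⟩

theorem lstar_unop_of_rstar {a b : Sᵐᵒᵖ} (hab : RStar a b) : LStar (unop a) (unop b) :=
  (lstar_op_of_rstar hab).map_equiv (MulEquiv.opOp S).symm

theorem rstar_unop_of_lstar {a b : Sᵐᵒᵖ} (hab : LStar a b) : RStar (unop a) (unop b) :=
  (rstar_op_of_lstar hab).map_equiv (MulEquiv.opOp S).symm

theorem TransposeBy.map {c₁ c₂ : LObj S} {d₁ d₂ : RObj S} {f : c₁ ⟶ c₂}
    {g : d₂ ⟶ d₁} {k₁ k₂ u : S} (hf : TransposeBy f g k₁ k₂ u) :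
    TransposeBy ((leftMap h).map f) ((rightMap h).map g) (h k₁) (h k₂) (h u) where
  idem₁ := hf.idem₁.map h
  idem₂ := hf.idem₂.map h
  left₁ := leftMap_obj_carrier h hf.idem₁ hf.left₁
  left₂ := leftMap_obj_carrier h hf.idem₂ hf.left₂
  right₁ := leftMap_obj_carrier (MulHom.op h) (k := op k₁) (congrArg op hf.idem₁) hf.right₁
  right₂ := leftMap_obj_carrier (MulHom.op h) (k := op k₂) (congrArg op hf.idem₂) hf.right₂
  mul_left := by rw [← map_mul, hf.mul_left]
  mul_right := by rw [← map_mul, hf.mul_right]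
  left := apply_leftMap_map h f hf.left
  right := apply_leftMap_map (MulHom.op h) g hf.right

theorem isCCMorphism_Omega [Abundant S] [Abundant T]
    (hL : ∀ a b, LStar a b → LStar (h a) (h b)) (hR : ∀ a b, RStar a b → RStar (h a) (h b)) :
    (Omega S).IsCCMorphism (Omega T) (leftMap h) (rightMap h) where
  left_incl := isIncl_leftMap_map h
  left_bimorphism := isBimorphism_leftMap_map h hL hR
  right_incl := isIncl_leftMap_map (MulHom.op h)
  right_bimorphism := isBimorphism_leftMap_map (MulHom.op h)
    (fun _ _ hab => lstar_op_of_rstar (hR _ _ (rstar_unop_of_lstar hab)))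
    (fun _ _ hab => rstar_op_of_lstar (hL _ _ (lstar_unop_of_rstar hab)))
  mem c d hcd := by
    obtain ⟨k, hk, h1, h2⟩ := mem_MSet_Γ_Omega_iff.1 hcd
    exact mem_MSet_Γ_Omega_iff.2 ⟨h k, hk.map h, leftMap_obj_carrier h hk h1,
      leftMap_obj_carrier (MulHom.op h) (k := op k) (congrArg op hk) h2⟩
  map_gamma c d γ γ' hγ hγ' A := by
    obtain ⟨k, hk, h1, h2⟩ := isGamma_Omega_iff.1 hγ
    obtain ⟨k', hk', h1', h2'⟩ := isGamma_Omega_iff.1 hγ'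
    have hkk : k' = h k := idem_ext hk' (hk.map h)
      ((vertex_of_pcone_eq hk' h2').symm.trans
        (leftMap_obj_carrier h hk (vertex_of_pcone_eq hk h2)))
      (h1'.symm.trans (leftMap_obj_carrier (MulHom.op h) (k := op k) (congrArg op hk) h1))
    refine LObj.hom_ext fun x => ?_
    rw [apply_of_pcone_eq h2', apply_leftMap_map h _ (apply_of_pcone_eq h2 A), hkk]
  transpose f g hfg := by
    obtain ⟨k₁, k₂, u, hu⟩ := isTranspose_Omega_iff.1 hfg
    exact isTranspose_Omega_iff.2 ⟨_, _, _, hu.map h⟩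

/-- Every presentation of (ρᵃ, λᵃ) has multiplier a, and applying the functors replaces it by h a.
So the image does not depend on the presentation, and a presentation by a bimorphism exists. -/
theorem mapsTo_Omega_iff [Abundant S] [Abundant T] (a : S) (p' : Cones (LObj T) × (Cones (RObj T))ᵐᵒᵖ) :
    (Omega S).MapsTo (Omega T) (leftMap h) (rightMap h) (principalPair a) p' ↔
      principalPair (h a) = p' := by
  constructor
  · rintro ⟨c, c', d, d', f, g, γ, δ, γ', δ', -, hfg, hγ, hδ, hγ', hδ', hp, rfl⟩
    obtain ⟨k₁, k₂, u, hu⟩ := isTranspose_Omega_iff.1 hfg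
    obtain ⟨h1, h2⟩ := hu.star hγ hδ
    obtain ⟨h3, h4⟩ := (hu.map h).star hγ' hδ'
    have hau : a = u := principalPair_injective (hp.trans (by rw [h1, h2]; rfl))
    rw [h3, h4, hau]
    rfl
  · rintro rfl
    obtain ⟨c₁, c₂, d₁, d₂, f, g, k₁, k₂, hu, hbi⟩ := exists_transposeBy a
    obtain ⟨γ, δ, hγ, hδ⟩ := hu.exists_cones
    obtain ⟨γ', δ', hγ', hδ'⟩ := (hu.map h).exists_cones
    obtain ⟨h1, h2⟩ := hu.star hγ hδ
    obtain ⟨h3, h4⟩ := (hu.map h).star hγ' hδ'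
    refine ⟨c₂, c₁, d₁, d₂, f, g, γ, δ, γ', δ', hbi, isTranspose_Omega_iff.2 ⟨_, _, _, hu⟩, hγ, hδ,
      hγ', hδ', ?_, ?_⟩
    · rw [h1, h2]; rfl
    · rw [h3, h4]; rfl

/-- A semigroup isomorphism is an isomorphism in `CS`. -/
def ConcSemigroup.isoOfMulEquiv {S T : ConcSemigroup.{u}} (e : S.carrier ≃* T.carrier) :
    S ≅ T where
  hom := ⟨e.toMulHom, fun _ _ h => h.map_equiv e, fun _ _ h => h.map_equiv e⟩
  inv := ⟨e.symm.toMulHom, fun _ _ h => h.map_equiv e.symm, fun _ _ h => h.map_equiv e.symm⟩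
  hom_inv_id := GoodHom.ext (MulHom.ext fun x => e.symm_apply_apply x)
  inv_hom_id := GoodHom.ext (MulHom.ext fun x => e.apply_symm_apply x)

end CCMorphism

end CrossConnections

/-! ### The theorem. -/

theorem mainTheorem7 :
    (∀ S : ConcSemigroup.{u}, (Omega S.carrier).IsCrossConnection) ∧
    (∀ (S T : ConcSemigroup.{u}) (h : S ⟶ T),
      (Omega S.carrier).IsCCMorphism (Omega T.carrier)
        (leftMap (GoodHom.toMulHom h)) (rightMap (GoodHom.toMulHom h))) ∧
    ∃ (hmul : ∀ S : ConcSemigroup.{u}, ∀ p ∈ (Omega S.carrier).linked,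
        ∀ q ∈ (Omega S.carrier).linked, p * q ∈ (Omega S.carrier).linked)
      (hconc : ∀ S : ConcSemigroup.{u}, Concordant ((Omega S.carrier).crossSemigroup (hmul S)))
      (Smap : ∀ {S T : ConcSemigroup.{u}}, (S ⟶ T) →
        ((⟨(Omega S.carrier).crossSemigroup (hmul S)⟩ : ConcSemigroup.{u}) ⟶
          (⟨(Omega T.carrier).crossSemigroup (hmul T)⟩ : ConcSemigroup.{u})))
      (Smap_id : ∀ S : ConcSemigroup.{u}, Smap (𝟙 S) = 𝟙 _)
      (Smap_comp : ∀ {S T U : ConcSemigroup.{u}} (h : S ⟶ T) (k : T ⟶ U),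
        Smap (h ≫ k) = Smap h ≫ Smap k)
      (φ : 𝟭 ConcSemigroup.{u} ≅
        { obj := fun S => ⟨(Omega S.carrier).crossSemigroup (hmul S)⟩
          map := Smap
          map_id := Smap_id
          map_comp := Smap_comp }),
      (∀ (S T : ConcSemigroup.{u}) (h : S ⟶ T)
        (p : (Omega S.carrier).crossSemigroup (hmul S))
        (p' : (Omega T.carrier).crossSemigroup (hmul T)),
        GoodHom.toMulHom (Smap h) p = p' ↔
          (Omega S.carrier).MapsTo (Omega T.carrier) (leftMap (GoodHom.toMulHom h))
            (rightMap (GoodHom.toMulHom h)) p p') ∧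
      ∀ (S : ConcSemigroup.{u}) (a : S.carrier),
        ((GoodHom.toMulHom (φ.hom.app S) a : (Omega S.carrier).crossSemigroup (hmul S)) :
          Cones (LObj S.carrier) × (Cones (RObj S.carrier))ᵐᵒᵖ) = principalPair a := by
  have hconc : ∀ S : ConcSemigroup.{u},
      Concordant ((Omega S.carrier).crossSemigroup (linked_Omega_mul S.carrier)) := fun S =>
    Concordant.of_mulEquiv (principalEquiv S.carrier)
  let Φ : ∀ S : ConcSemigroup.{u}, S ≅
      (⟨(Omega S.carrier).crossSemigroup (linked_Omega_mul S.carrier)⟩ : ConcSemigroup.{u}) :=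
    fun S => ConcSemigroup.isoOfMulEquiv (principalEquiv S.carrier)
  -- Taking 𝕊Ωh to be the conjugate of h by the isomorphisms Φ makes goodness, functoriality and
  -- naturality formal; only its agreement with the defining graph is left to check.
  refine ⟨fun S => isCrossConnection_Omega S.carrier,
    fun S T h => isCCMorphism_Omega (GoodHom.toMulHom h) (GoodHom.map_lstar h)
      (GoodHom.map_rstar h),
    fun S => linked_Omega_mul S.carrier, hconc, fun {S T} h => (Φ S).inv ≫ h ≫ (Φ T).hom,
    fun S => by simp, fun {S T U} h k => by simp,
    NatIso.ofComponents Φ fun {S T} h => by simp, fun S T h p p' => ?_, fun S a => rfl⟩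
  obtain ⟨a, rfl⟩ := (principalEquiv S.carrier).surjective p
  have h1 : GoodHom.toMulHom ((Φ S).inv ≫ h ≫ (Φ T).hom) (principalEquiv S.carrier a) =
      principalEquiv T.carrier (GoodHom.toMulHom h a) :=
    congrArg (fun x => principalEquiv T.carrier (GoodHom.toMulHom h x))
      ((principalEquiv S.carrier).symm_apply_apply a)
  rw [principalEquiv_apply, mapsTo_Omega_iff, ← principalEquiv_apply]
  refine Iff.trans ?_ Subtype.ext_iff
  exact ⟨fun h2 => h1.symm.trans h2, fun h2 => h1.trans h2⟩
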